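/- Let $\varphi_0=e^{123}+e^{145}+e^{167}+e^{246}-e^{257}-e^{347}-e^{356}$ on Euclidean space $\mathbb R^7$, and let $\times$ be the cross product defined by $\langle u\times v,w\rangle=\varphi_0(u,v,w)$. Let $G(3,7)$ be the Grassmannian manifold of oriented $3$-planes in $\mathbb R^7$, with canonical bundle $\mathbb E$ (whose fibre at $L$ is $L$) and complementary bundle $\mathbb V=\mathbb E^\perp$ (whose fibre at $L$ is $L^\perp$). Identify $TG(3,7)$ with $\mathbb E^*\otimes\mathbb V$ by the canonical isomorphism, under which the velocity at $t=0$ of a curve of planes $L(t)$ with $L(0)=L$ is the homomorphism $L\to L^\perp$ that sends $e(0)$ to the component of $\dot e(0)$ orthogonal to $L$, for every differentiable curve of vectors $e(t)\in L(t)$. Let $G^{\varphi_0}(3,7)=\{L\in G(3,7) : \varphi_0|_L=\mathrm{vol}(L)\}$ be the set of associative planes. Then $G^{\varphi_0}(3,7)$ is a smooth embedded submanifold of $G(3,7)$ (of dimension $8$). If $L\in G^{\varphi_0}(3,7)$ and $\{e_1,e_2,e_3\}$ is an orthonormal basis of $L$ with $e_3=e_1\times e_2$ and dual basis $\{e^1,e^2,e^3\}$,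 then $$T_LG^{\varphi_0}(3,7)=\Big\{\sum_{j=1}^3 e^j\otimes v_j\in \mathbb E_L^*\otimes\mathbb V_L \;:\; \sum_{j=1}^3 e_j\times v_j=0\Big\}.$$ Moreover, the normal bundle $TG(3,7)|_{G^{\varphi_0}(3,7)}/TG^{\varphi_0}(3,7)$ is isomorphic, as a smooth vector bundle over $G^{\varphi_0}(3,7)$, to the restriction of $\mathbb V$, by the isomorphism which at $L$ sends the class of $\sum e^j\otimes v_j$ to $\sum e_j\times v_j$ (for any basis of $L$ as above). -/

import Mathlib

open Set Module
open scoped Manifold ContDiff TensorProduct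

noncomputable section

/-! ### The standard `3`-form and the cross product of `ℝ⁷` -/

/-- Euclidean `7`-space. -/
abbrev R7 : Type := EuclideanSpace ℝ (Fin 7)

/-- The `3`-form `eⁱ ∧ eʲ ∧ eᵏ` on `ℝ⁷`; its value on `(u, v, w)` is the `3 × 3` determinant of the
coordinates with indices `i, j, k`. -/
def wedge3 (i j k : Fin 7) : R7 [⋀^Fin 3]→ₗ[ℝ] ℝ :=
  (Matrix.detRowAlternating : (Fin 3 → ℝ) [⋀^Fin 3]→ₗ[ℝ] ℝ).compLinearMap
    ((LinearMap.funLeft ℝ ℝ ![i, j, k]).comp (WithLp.linearEquiv 2 ℝ (Fin 7 → ℝ)).toLinearMap)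

/-- The standard `G₂`-form
`φ₀ = e¹²³ + e¹⁴⁵ + e¹⁶⁷ + e²⁴⁶ - e²⁵⁷ - e³⁴⁷ - e³⁵⁶` (the indices below start at `0`). -/
def phi0 : R7 [⋀^Fin 3]→ₗ[ℝ] ℝ :=
  wedge3 0 1 2 + wedge3 0 3 4 + wedge3 0 5 6 + wedge3 1 3 5
    - wedge3 1 4 6 - wedge3 2 3 6 - wedge3 2 4 5

/-- The cross product of `ℝ⁷`, characterized by `⟨u × v, w⟩ = φ₀(u, v, w)`
(see `inner_cross`): its `k`-th coordinate is `φ₀(u, v, e_k)`. -/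
def cross (u v : R7) : R7 :=
  WithLp.toLp 2 fun k => phi0 ![u, v, EuclideanSpace.single k 1]

theorem inner_cross (u v w : R7) : inner ℝ (cross u v) w = phi0 ![u, v, w] := by
  have hw : w = ∑ k, w k • EuclideanSpace.single k (1 : ℝ) := by
    ext i
    simp [Finset.sum_apply, Pi.single_apply]
  have hlin : ∀ x : R7, phi0 ![u, v, x] =
      (phi0.toMultilinearMap.toLinearMap ![u, v, 0] 2) x := by
    intro x
    simp only [MultilinearMap.toLinearMap_apply, AlternatingMap.coe_multilinearMap]
    congr 1
    ext j
    fin_cases j <;> simp [Function.update]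
  rw [hlin]
  conv_rhs => rw [hw]
  rw [map_sum, PiLp.inner_apply]
  refine Finset.sum_congr rfl fun k _ => ?_
  rw [map_smul, ← hlin]
  simp [cross]

/-! ### Oriented `3`-planes and the smooth manifold `G(3,7)` -/

/-- An oriented `3`-dimensional linear subspace of `ℝ⁷`, that is, a point of `G(3,7)`. -/
structure OrientedPlane where
  /-- the underlying linear subspace -/
  plane : Submodule ℝ R7
  /-- it has dimension three -/
  finrank_eq : finrank ℝ plane = 3
  /-- the orientation of the subspace -/
  orientation : Orientation ℝ plane (Fin 3)

namespace OrientedPlane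

instance (L : OrientedPlane) : Fact (finrank ℝ L.plane = 3) := ⟨L.finrank_eq⟩

/-- The standard orientation of `ℝ³`. -/
def stdOrientation : Orientation ℝ (Fin 3 → ℝ) (Fin 3) := (Pi.basisFun ℝ (Fin 3)).orientation

/-- The image of an injective linear map `ℝ³ → ℝ⁷`, with the orientation carried over from `ℝ³`. -/
def ofInjective (f : (Fin 3 → ℝ) →ₗ[ℝ] R7) (hf : Function.Injective f) : OrientedPlane where
  plane := LinearMap.range f
  finrank_eq := by simp [LinearMap.finrank_range_of_inj hf]
  orientation := Orientation.map (Fin 3) (LinearEquiv.ofInjective f hf) stdOrientation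

theorem eq_ofInjective_iff (L : OrientedPlane) (f : (Fin 3 → ℝ) →ₗ[ℝ] R7)
    (hf : Function.Injective f) :
    L = ofInjective f hf ↔ ∃ k : (Fin 3 → ℝ) ≃ₗ[ℝ] L.plane,
      (∀ x, (k x : R7) = f x) ∧ Orientation.map (Fin 3) k stdOrientation = L.orientation := by
  constructor
  · rintro rfl
    exact ⟨LinearEquiv.ofInjective f hf, fun x => rfl, rfl⟩
  · rintro ⟨k, hk, ho⟩
    obtain ⟨M, hM, o⟩ := L
    simp only at k hk ho
    have hMf : M = LinearMap.range f := by
      ext y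
      constructor
      · intro hy
        exact ⟨k.symm ⟨y, hy⟩, by rw [← hk]; simp⟩
      · rintro ⟨x, rfl⟩
        rw [← hk]
        exact (k x).2
    subst hMf
    have : k = LinearEquiv.ofInjective f hf := by
      ext x
      simp [hk]
    subst this
    unfold ofInjective
    congr 1
    exact ho.symm

theorem exists_eq_ofInjective (L : OrientedPlane) :
    ∃ (f : (Fin 3 → ℝ) →ₗ[ℝ] R7) (hf : Function.Injective f), L = ofInjective f hf := by
  let B := L.orientation.someBasis (by simp [L.finrank_eq])
  have hinj : Function.Injective (L.plane.subtype.comp B.equivFun.symm.toLinearMap) :=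
    L.plane.injective_subtype.comp B.equivFun.symm.injective
  refine ⟨_, hinj, ?_⟩
  rw [eq_ofInjective_iff]
  refine ⟨B.equivFun.symm, fun x => rfl, ?_⟩
  rw [stdOrientation, ← Basis.orientation_map]
  have : (Pi.basisFun ℝ (Fin 3)).map B.equivFun.symm = B := by
    ext i
    simp
  rw [this]
  exact L.orientation.someBasis_orientation _

theorem ofInjective_eq_iff (f g : (Fin 3 → ℝ) →ₗ[ℝ] R7) (hf : Function.Injective f)
    (hg : Function.Injective g) :
    ofInjective f hf = ofInjective g hg ↔
      ∃ h : (Fin 3 → ℝ) ≃ₗ[ℝ] (Fin 3 → ℝ),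
        0 < LinearMap.det (h : (Fin 3 → ℝ) →ₗ[ℝ] (Fin 3 → ℝ)) ∧ ∀ x, f (h x) = g x := by
  have key : ∀ h : (Fin 3 → ℝ) ≃ₗ[ℝ] (Fin 3 → ℝ),
      Orientation.map (Fin 3) h stdOrientation = stdOrientation ↔
        0 < LinearMap.det (h : (Fin 3 → ℝ) →ₗ[ℝ] (Fin 3 → ℝ)) :=
    fun h => Orientation.map_eq_iff_det_pos _ h (by simp)
  have mapc : ∀ h : (Fin 3 → ℝ) ≃ₗ[ℝ] (Fin 3 → ℝ),
      Orientation.map (Fin 3) (h.trans (LinearEquiv.ofInjective f hf)) stdOrientation =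
      Orientation.map (Fin 3) (LinearEquiv.ofInjective f hf)
        (Orientation.map (Fin 3) h stdOrientation) := by
    intro h
    rw [stdOrientation, ← Basis.orientation_map, ← Basis.orientation_map, ← Basis.orientation_map]
    rfl
  rw [eq_ofInjective_iff]
  constructor
  · rintro ⟨k, hk, ho⟩
    refine ⟨k.trans (LinearEquiv.ofInjective f hf).symm, ?_, fun x => ?_⟩
    · rw [← key]
      apply (Orientation.map (Fin 3) (LinearEquiv.ofInjective f hf)).injective
      rw [← mapc]
      have : (k.trans (LinearEquiv.ofInjective f hf).symm).trans
          (LinearEquiv.ofInjective f hf) = k := by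
        refine LinearEquiv.ext fun x => ?_
        exact LinearEquiv.apply_symm_apply (LinearEquiv.ofInjective f hf) (k x)
      rw [this]
      exact ho
    · rw [← hk x]
      have := LinearEquiv.apply_symm_apply (LinearEquiv.ofInjective f hf) (k x)
      exact congrArg Subtype.val this
  · rintro ⟨h, hdet, hh⟩
    refine ⟨h.trans (LinearEquiv.ofInjective f hf), fun x => hh x, ?_⟩
    refine (mapc h).trans ?_
    rw [(key h).2 hdet]
    rfl

/-- The vector space `Hom(ℝ³, ℝ⁴)` on which `G(3,7)` is modelled. -/
abbrev Model : Type := (Fin 3 → ℝ) →L[ℝ] (Fin 4 → ℝ)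

/-- A splitting `ℝ³ × ℝ⁴ ≅ ℝ⁷`. -/
abbrev Splitting : Type := ((Fin 3 → ℝ) × (Fin 4 → ℝ)) ≃L[ℝ] R7

/-- The embedding `ℝ³ → ℝ⁷`, `x ↦ b (x, A x)`, of the graph of `A`. -/
def graphMap (b : Splitting) (A : Model) : (Fin 3 → ℝ) →ₗ[ℝ] R7 :=
  b.toLinearEquiv.toLinearMap.comp (LinearMap.id.prod A.toLinearMap)

@[simp] theorem graphMap_apply (b : Splitting) (A : Model) (x : Fin 3 → ℝ) :
    graphMap b A x = b (x, A x) := rfl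

theorem graphMap_injective (b : Splitting) (A : Model) : Function.Injective (graphMap b A) := by
  intro x y h
  exact congrArg Prod.fst (b.injective h)

/-- The graph of `A`, as an oriented `3`-plane of `ℝ⁷ ≅ ℝ³ × ℝ⁴`. -/
def graph (b : Splitting) (A : Model) : OrientedPlane :=
  ofInjective (graphMap b A) (graphMap_injective b A)

/-- The block `ℝ³ → ℝ³` of a change of splitting, along the graph of `A`. -/
def blockFst (b b' : Splitting) (A : Model) : (Fin 3 → ℝ) →L[ℝ] (Fin 3 → ℝ) :=
  (ContinuousLinearMap.fst ℝ (Fin 3 → ℝ) (Fin 4 → ℝ)).comp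
    ((b.trans b'.symm : _ →L[ℝ] _).comp ((ContinuousLinearMap.id ℝ _).prod A))

/-- The block `ℝ³ → ℝ⁴` of a change of splitting, along the graph of `A`. -/
def blockSnd (b b' : Splitting) (A : Model) : (Fin 3 → ℝ) →L[ℝ] (Fin 4 → ℝ) :=
  (ContinuousLinearMap.snd ℝ (Fin 3 → ℝ) (Fin 4 → ℝ)).comp
    ((b.trans b'.symm : _ →L[ℝ] _).comp ((ContinuousLinearMap.id ℝ _).prod A))

theorem blocks_apply (b b' : Splitting) (A : Model) (x : Fin 3 → ℝ) :
    b' (blockFst b b' A x, blockSnd b b' A x) = b (x, A x) := by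
  have : (blockFst b b' A x, blockSnd b b' A x) = b'.symm (b (x, A x)) := rfl
  rw [this, ContinuousLinearEquiv.apply_symm_apply]

theorem contDiff_id_prod {n : ℕ∞ω} :
    ContDiff ℝ n fun A : Model => (ContinuousLinearMap.id ℝ (Fin 3 → ℝ)).prod A := by
  have : (fun A : Model => (ContinuousLinearMap.id ℝ (Fin 3 → ℝ)).prod A) = fun A =>
      ContinuousLinearMap.inl ℝ (Fin 3 → ℝ) (Fin 4 → ℝ) +
        (ContinuousLinearMap.inr ℝ (Fin 3 → ℝ) (Fin 4 → ℝ)).comp A := by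
    funext A
    refine ContinuousLinearMap.ext fun x => ?_
    simp
  rw [this]
  exact contDiff_const.add (contDiff_const.clm_comp contDiff_id)

theorem contDiff_blockFst (b b' : Splitting) {n : ℕ∞ω} : ContDiff ℝ n (blockFst b b') := by
  exact contDiff_const.clm_comp (contDiff_const.clm_comp contDiff_id_prod)

theorem contDiff_blockSnd (b b' : Splitting) {n : ℕ∞ω} : ContDiff ℝ n (blockSnd b b') := by
  exact contDiff_const.clm_comp (contDiff_const.clm_comp contDiff_id_prod)

theorem graph_eq_graph_iff (b b' : Splitting) (A A' : Model) :
    graph b A = graph b' A' ↔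
      0 < (blockFst b b' A).det ∧ A' = (blockSnd b b' A).comp (blockFst b b' A).inverse := by
  unfold graph
  rw [ofInjective_eq_iff]
  constructor
  · rintro ⟨h, hdet, hh⟩
    have h1 : ∀ x, blockFst b b' A (h x) = x ∧ blockSnd b b' A (h x) = A' x := by
      intro x
      have := hh x
      rw [graphMap_apply, graphMap_apply, ← blocks_apply b b'] at this
      exact Prod.ext_iff.1 (b'.injective this)
    have hP : blockFst b b' A = (h.symm.toContinuousLinearEquiv : _ →L[ℝ] _) := by
      ext1 x
      have := (h1 (h.symm x)).1
      rw [h.apply_symm_apply] at this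
      simpa using this
    refine ⟨?_, ?_⟩
    · rw [hP]
      change 0 < LinearMap.det (h.symm : (Fin 3 → ℝ) →ₗ[ℝ] (Fin 3 → ℝ))
      rw [LinearEquiv.det_coe_symm]
      exact inv_pos.2 hdet
    · rw [hP, ContinuousLinearMap.inverse_equiv]
      ext1 x
      exact ((h1 x).2).symm
  · rintro ⟨hdet, rfl⟩
    let p : (Fin 3 → ℝ) ≃ₗ[ℝ] (Fin 3 → ℝ) :=
      LinearEquiv.ofIsUnitDet
        (v := Pi.basisFun ℝ (Fin 3)) (v' := Pi.basisFun ℝ (Fin 3))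
        (f := (blockFst b b' A).toLinearMap)
        (by
          rw [LinearMap.det_toMatrix]
          exact (ne_of_gt hdet).isUnit)
    have hp : ∀ x, p x = blockFst b b' A x := fun x => rfl
    have hP : blockFst b b' A = (p.toContinuousLinearEquiv : _ →L[ℝ] _) := by
      ext1 x
      exact (hp x).symm
    refine ⟨p.symm, ?_, fun x => ?_⟩
    · rw [LinearEquiv.det_coe_symm]
      exact inv_pos.2 hdet
    · have hx : (blockFst b b' A).inverse x = p.symm x := by
        rw [hP, ContinuousLinearMap.inverse_equiv]
        rfl
      rw [graphMap_apply, graphMap_apply, ← blocks_apply b b', ← hp, p.apply_symm_apply]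
      rw [ContinuousLinearMap.comp_apply, hx]

theorem graph_injective (b : Splitting) : Function.Injective (graph b) := by
  intro A A' h
  have h1 := ((graph_eq_graph_iff b b A A').1 h).2
  have h2 := ((graph_eq_graph_iff b b A A).1 rfl).2
  rw [h1, ← h2]

/-- The chart of `G(3,7)` given by a splitting `b : ℝ³ × ℝ⁴ ≅ ℝ⁷`: it sends the graph of
`A : ℝ³ → ℝ⁴`, oriented by `ℝ³`, to `A`. -/
def graphChart (b : Splitting) : PartialEquiv OrientedPlane Model where
  toFun := Function.invFun (graph b)
  invFun := graph b
  source := range (graph b)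
  target := univ
  map_source' _ _ := mem_univ _
  map_target' A _ := mem_range_self A
  left_inv' _ hL := Function.invFun_eq hL
  right_inv' A _ := Function.leftInverse_invFun (graph_injective b) A

theorem exists_mem_graphChart_source (L : OrientedPlane) :
    ∃ b : Splitting, L ∈ (graphChart b).source := by
  obtain ⟨f, hf, rfl⟩ := exists_eq_ofInjective L
  obtain ⟨W, hW⟩ := Submodule.exists_isCompl (LinearMap.range f)
  have hfr : finrank ℝ (LinearMap.range f) = 3 := by
    simp [LinearMap.finrank_range_of_inj hf]
  have hWr : finrank ℝ W = 4 := by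
    have := Submodule.finrank_add_eq_of_isCompl hW
    rw [hfr] at this
    simp at this
    omega
  let w : (Fin 4 → ℝ) ≃ₗ[ℝ] W := LinearEquiv.ofFinrankEq _ _ (by simp [hWr])
  let c : ((Fin 3 → ℝ) × (Fin 4 → ℝ)) ≃ₗ[ℝ] R7 :=
    ((LinearEquiv.ofInjective f hf).prodCongr w).trans
      (Submodule.prodEquivOfIsCompl _ _ hW)
  refine ⟨c.toContinuousLinearEquiv, 0, ?_⟩
  unfold graph
  congr 1
  refine LinearMap.ext fun x => ?_
  simp [c]

theorem graphChart_trans_source (b b' : Splitting) :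
    ((graphChart b).symm.trans (graphChart b')).source = {A | 0 < (blockFst b b' A).det} := by
  ext A
  simp only [PartialEquiv.trans_source, mem_inter_iff, mem_preimage, mem_ofPred_eq]
  constructor
  · rintro ⟨-, A', hA'⟩
    exact ((graph_eq_graph_iff b b' A A').1 hA'.symm).1
  · intro h
    exact ⟨mem_univ _, _, ((graph_eq_graph_iff b b' A _).2 ⟨h, rfl⟩).symm⟩

theorem graphChart_trans_apply (b b' : Splitting) {A : Model}
    (hA : A ∈ ((graphChart b).symm.trans (graphChart b')).source) :
    (graphChart b).symm.trans (graphChart b') A =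
      (blockSnd b b' A).comp (blockFst b b' A).inverse := by
  rw [graphChart_trans_source] at hA
  have h : graph b A = graph b' ((blockSnd b b' A).comp (blockFst b b' A).inverse) :=
    (graph_eq_graph_iff b b' A _).2 ⟨hA, rfl⟩
  change Function.invFun (graph b') (graph b A) = _
  rw [h, Function.leftInverse_invFun (graph_injective b')]

theorem contDiffOn_graphChart_trans (b b' : Splitting) {n : ℕ∞ω} :
    ContDiffOn ℝ n ((graphChart b).symm.trans (graphChart b'))
      ((graphChart b).symm.trans (graphChart b')).source := by
  refine ContDiffOn.congr ?_ fun A hA => graphChart_trans_apply b b' hA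
  rw [graphChart_trans_source]
  intro A hA
  apply ContDiffAt.contDiffWithinAt
  have hdet : IsUnit (blockFst b b' A).det := (ne_of_gt hA).isUnit
  have hP : blockFst b b' A =
      ((blockFst b b' A).toContinuousLinearEquivOfDetNeZero (ne_of_gt hA) : _ →L[ℝ] _) := by
    simp
  have hinv : ContDiffAt ℝ n ContinuousLinearMap.inverse (blockFst b b' A) := by
    rw [hP]
    exact contDiffAt_map_inverse _
  exact (contDiff_blockSnd b b').contDiffAt.clm_comp
    (ContDiffAt.comp A hinv (contDiff_blockFst b b').contDiffAt)

theorem isOpen_graphChart_trans_source (b b' : Splitting) :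
    IsOpen ((graphChart b).symm.trans (graphChart b')).source := by
  rw [graphChart_trans_source]
  exact isOpen_lt continuous_const (ContinuousLinearMap.continuous_det.comp
    (contDiff_blockFst b b' (n := 0)).continuous)

/-- The atlas of `G(3,7)` formed by all graph charts. -/
def core : ChartedSpaceCore Model OrientedPlane where
  atlas := range graphChart
  chartAt L := graphChart (exists_mem_graphChart_source L).choose
  mem_chart_source L := (exists_mem_graphChart_source L).choose_spec
  chart_mem_atlas _ := mem_range_self _
  open_source := by
    rintro _ _ ⟨b, rfl⟩ ⟨b', rfl⟩
    exact isOpen_graphChart_trans_source b b'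
  continuousOn_toFun := by
    rintro _ _ ⟨b, rfl⟩ ⟨b', rfl⟩
    exact (contDiffOn_graphChart_trans b b' (n := 0)).continuousOn

instance : TopologicalSpace OrientedPlane := core.toTopologicalSpace

instance : ChartedSpace Model OrientedPlane := core.toChartedSpace

instance (n : ℕ∞ω) : IsManifold 𝓘(ℝ, Model) n OrientedPlane := by
  apply isManifold_of_contDiffOn
  intro e e' he he'
  obtain ⟨c, hc, he⟩ := mem_iUnion₂.1 he
  obtain ⟨c', hc', he'⟩ := mem_iUnion₂.1 he'
  obtain ⟨b, rfl⟩ := hc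
  obtain ⟨b', rfl⟩ := hc'
  rw [mem_singleton_iff] at he he'
  subst he
  subst he'
  simp only [modelWithCornersSelf_coe, modelWithCornersSelf_coe_symm, preimage_id, range_id,
    inter_univ]
  exact contDiffOn_graphChart_trans b b'

/-! ### Tangent vectors of `G(3,7)` as elements of `E* ⊗ V` -/

/-- The orthogonal projection of `ℝ⁷` onto the plane `L`, as a function of `L`. -/
def proj (L : OrientedPlane) : R7 →L[ℝ] R7 := L.plane.starProjection

/-- The fibre at `L` of the canonical bundle `E` is the plane `L` itself. -/
abbrev E (L : OrientedPlane) : Submodule ℝ R7 := L.plane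

/-- The fibre at `L` of the complementary bundle `V = E^⊥`. -/
abbrev V (L : OrientedPlane) : Submodule ℝ R7 := L.planeᗮ

/-- The derivative at `L`, in the direction `ξ`, of the projection onto the plane. -/
def dproj (L : OrientedPlane) : TangentSpace 𝓘(ℝ, Model) L →L[ℝ] (R7 →L[ℝ] R7) :=
  mfderiv 𝓘(ℝ, Model) 𝓘(ℝ, R7 →L[ℝ] R7) proj L

/-- The homomorphism `E_L → V_L` defined by a tangent vector `ξ` of `G(3,7)` at `L`. It sends `x`
to the normal component of the derivative of the projection of `x` onto the moving plane.
If the plane moves along a curve `L(t)` and `e(t) ∈ L(t)`, then differentiating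
`proj (L(t)) (e(t)) = e(t)` shows that `e(0)` is sent to the component of `e'(0)` orthogonal to
`L(0)`, which is the usual identification. -/
def tangentToHom (L : OrientedPlane) : TangentSpace 𝓘(ℝ, Model) L →ₗ[ℝ] (L.E →ₗ[ℝ] L.V) where
  toFun ξ := L.V.orthogonalProjectionOnto.toLinearMap ∘ₗ (dproj L ξ).toLinearMap ∘ₗ L.E.subtype
  map_add' ξ η := by
    ext x
    simp
  map_smul' c ξ := by
    ext x
    simp

/-- The canonical map `T_L G(3,7) → E_L* ⊗ V_L`. -/
def tangentToTensor (L : OrientedPlane) :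
    TangentSpace 𝓘(ℝ, Model) L →ₗ[ℝ] Dual ℝ L.E ⊗[ℝ] L.V :=
  (dualTensorHomEquiv ℝ L.E L.V).symm.toLinearMap ∘ₗ tangentToHom L

/-- The oriented plane `L` is associative: `φ₀` restricted to `L` is the volume form of `L`. -/
def IsAssociative (L : OrientedPlane) : Prop :=
  phi0.compLinearMap L.plane.subtype = L.orientation.volumeForm

end OrientedPlane

open OrientedPlane

/-! ### The associative Grassmannian and its normal bundle -/

/-- The set of associative `3`-planes in `G(3,7)`, with the subspace topology. -/
abbrev AssociativeGrassmannian : Type := {L : OrientedPlane // L.IsAssociative}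

section Submanifold

variable [ChartedSpace (EuclideanSpace ℝ (Fin 8)) AssociativeGrassmannian]

/-- The tangent space at `L` of the associative Grassmannian, inside `T_L G(3,7)`: the image of
the differential of the inclusion. -/
def assocTangent (L : AssociativeGrassmannian) :
    Submodule ℝ (TangentSpace 𝓘(ℝ, Model) L.1) :=
  LinearMap.range (mfderiv (𝓡 8) 𝓘(ℝ, Model)
    (Subtype.val : AssociativeGrassmannian → OrientedPlane) L).toLinearMap

/-- The fibre at `L` of the normal bundle of the associative Grassmannian in `G(3,7)`. -/
abbrev AssocNormalSpace (L : AssociativeGrassmannian) : Type :=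
  TangentSpace 𝓘(ℝ, Model) L.1 ⧸ assocTangent L

open scoped Classical in
/-- For a family of linear maps `Φ L : N_L → V_L` on the fibres of the normal bundle, the map on
`TG(3,7)` which sends a tangent vector at an associative plane `L` to the image under `Φ L` of its
class; the value at all other tangent vectors is irrelevant. -/
def normalMapLift (Φ : ∀ L : AssociativeGrassmannian, AssocNormalSpace L ≃ₗ[ℝ] L.1.V)
    (p : TangentBundle 𝓘(ℝ, Model) OrientedPlane) : R7 :=
  if h : p.proj.IsAssociative then Φ ⟨p.proj, h⟩ (Submodule.Quotient.mk p.snd) else 0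

/-- An isomorphism of smooth vector bundles over the associative Grassmannian, from its normal
bundle `N = TG(3,7)| / T` to the restriction of `V`, a subbundle of the trivial bundle with
fibre `ℝ⁷`. It is a family of linear isomorphisms of the fibres that depends smoothly on the base
point. The quotient map `q : TG(3,7)| → N` is a surjective submersion, so that the family is a
smooth map on `N` exactly if its composition with `q` is smooth on `TG(3,7)|`; and a smooth bundle
map which is bijective on every fibre has a smooth inverse. -/
structure NormalBundleIso where
  /-- the isomorphism of the fibres over `L` -/
  toEquiv : ∀ L : AssociativeGrassmannian, AssocNormalSpace L ≃ₗ[ℝ] L.1.V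
  /-- it depends smoothly on the base point -/
  contMDiffOn : ContMDiffOn 𝓘(ℝ, Model).tangent 𝓘(ℝ, R7) ∞ (normalMapLift toEquiv)
    {p : TangentBundle 𝓘(ℝ, Model) OrientedPlane | p.proj.IsAssociative}

end Submanifold

end

noncomputable section

/-! ### Algebra of the cross product -/

/-! A plane spanned by `u₀, u₁, u₂` in this orientation is associative exactly when `u₀ × u₁` lies
in it with positive `u₂`-component (`isAssociative_ofInjective_iff`). For the graph of `A : ℝ³ → ℝ⁴`
this determines the image of the third basis vector as a smooth function of the other two images, on
an open set (`isAssociative_graph_iff`). Subtracting that function is a shear that straightens the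
associative planes to a linear subspace of dimension 12 - 4 = 8, which gives slice charts and hence
an embedded submanifold.

For the tangent space, an associative plane is closed under the cross product, so its projection `P`
satisfies `P(Pu × Pv) = Pu × Pv`. Differentiating on a frame with `e₂ = e₀ × e₁` gives `v₂ = v₀ × e₁
+ e₀ × v₁`, and anti-associativity on orthogonal triples turns this into `∑ eⱼ × vⱼ = 0`. Thus the
tangent space lies in the kernel of the contraction `∑ eʲ ⊗ vⱼ ↦ ∑ eⱼ × vⱼ`. This contraction maps
onto the 4-dimensional `L^⊥`, so its kernel also has dimension 8 and the two agree.

The normal bundle isomorphism is then the first isomorphism theorem in each fibre. It is smooth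
because the contraction is a trace over `ℝ⁷` of an expression polynomial in `P` and `dP`
(`crossTrace`), and `P = M(MᵀM)⁻¹Mᵀ` is smooth in the plane. -/

theorem wedge3_apply (i j k : Fin 7) (u v w : R7) : wedge3 i j k ![u, v, w] =
    u i * v j * w k - u i * v k * w j - u j * v i * w k + u j * v k * w i + u k * v i * w j
      - u k * v j * w i := by
  have : wedge3 i j k ![u, v, w] =
      (Matrix.of ![![u i, u j, u k], ![v i, v j, v k], ![w i, w j, w k]]).det := by
    change Matrix.det (_ : Matrix (Fin 3) (Fin 3) ℝ) = _
    congr 1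
    ext a c
    fin_cases a <;> fin_cases c <;> rfl
  rw [this, Matrix.det_fin_three]
  simp

theorem cross_eq_vec (u v : R7) : cross u v = !₂[
    u 1 * v 2 - u 2 * v 1 + (u 3 * v 4 - u 4 * v 3) + (u 5 * v 6 - u 6 * v 5),
    u 2 * v 0 - u 0 * v 2 + (u 3 * v 5 - u 5 * v 3) - (u 4 * v 6 - u 6 * v 4),
    u 0 * v 1 - u 1 * v 0 - (u 3 * v 6 - u 6 * v 3) - (u 4 * v 5 - u 5 * v 4),
    u 4 * v 0 - u 0 * v 4 + (u 5 * v 1 - u 1 * v 5) - (u 6 * v 2 - u 2 * v 6),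
    u 0 * v 3 - u 3 * v 0 - (u 6 * v 1 - u 1 * v 6) - (u 5 * v 2 - u 2 * v 5),
    u 6 * v 0 - u 0 * v 6 + (u 1 * v 3 - u 3 * v 1) - (u 2 * v 4 - u 4 * v 2),
    u 0 * v 5 - u 5 * v 0 - (u 1 * v 4 - u 4 * v 1) - (u 2 * v 3 - u 3 * v 2)] := by
  ext k
  fin_cases k <;>
    simp [cross, phi0, wedge3_apply] <;> ring

/-- The cross product as a bilinear map. -/
def crossLin : R7 →ₗ[ℝ] R7 →ₗ[ℝ] R7 :=
  LinearMap.mk₂ ℝ cross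
    (fun u u' v => by ext k; fin_cases k <;> simp [cross_eq_vec] <;> ring)
    (fun c u v => by ext k; fin_cases k <;> simp [cross_eq_vec] <;> ring)
    (fun u v v' => by ext k; fin_cases k <;> simp [cross_eq_vec] <;> ring)
    (fun c u v => by ext k; fin_cases k <;> simp [cross_eq_vec] <;> ring)

theorem crossLin_apply (u v : R7) : crossLin u v = cross u v := rfl

theorem cross_swap (u v : R7) : cross u v = -cross v u := by
  ext k; fin_cases k <;> simp [cross_eq_vec] <;> ring

theorem cross_self_eq_zero (u : R7) : cross u u = 0 := by
  ext k; fin_cases k <;> simp [cross_eq_vec] <;> ring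

theorem inner_eq_sum (u v : R7) : (inner ℝ u v : ℝ) =
    u 0 * v 0 + u 1 * v 1 + u 2 * v 2 + u 3 * v 3 + u 4 * v 4 + u 5 * v 5 + u 6 * v 6 := by
  rw [PiLp.inner_apply, Fin.sum_univ_seven]
  simp only [RCLike.inner_apply, conj_trivial]
  ring

/-- For imaginary octonions this is the alternative law; the other double product identities rest on
it. -/
theorem cross_cross_self (u v : R7) :
    cross u (cross u v) = (inner ℝ u v : ℝ) • u - (inner ℝ u u : ℝ) • v := by
  ext k
  rw [inner_eq_sum, inner_eq_sum]
  fin_cases k <;> simp [cross_eq_vec] <;> ring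

theorem inner_cross_swap (u v w : R7) :
    (inner ℝ (cross u v) w : ℝ) = -inner ℝ v (cross u w) := by
  rw [inner_eq_sum, inner_eq_sum]
  simp [cross_eq_vec]
  ring

theorem inner_cross_left (u v : R7) : (inner ℝ u (cross u v) : ℝ) = 0 := by
  rw [inner_eq_sum]
  simp [cross_eq_vec]
  ring

theorem inner_cross_right (u v : R7) : (inner ℝ v (cross u v) : ℝ) = 0 := by
  rw [inner_eq_sum]
  simp [cross_eq_vec]
  ring

theorem inner_cross_cross_self (u v : R7) : (inner ℝ (cross u v) (cross u v) : ℝ) =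
    inner ℝ u u * inner ℝ v v - inner ℝ u v ^ 2 := by
  rw [inner_cross_swap, cross_cross_self, inner_sub_right, inner_smul_right, inner_smul_right,
    real_inner_comm u v]
  ring

/-- The polarization of `cross_cross_self` in its repeated argument. -/
theorem cross_cross_add (u v w : R7) : cross u (cross v w) + cross v (cross u w) =
    (inner ℝ u w : ℝ) • v + (inner ℝ v w : ℝ) • u - (2 * inner ℝ u v : ℝ) • w := by
  ext k
  rw [inner_eq_sum, inner_eq_sum, inner_eq_sum]
  fin_cases k <;> simp [cross_eq_vec] <;> ring

theorem cross_cross_of_orthogonal {u v w : R7} (huv : (inner ℝ u v : ℝ) = 0)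
    (huw : (inner ℝ u w : ℝ) = 0) (hvw : (inner ℝ v w : ℝ) = 0) :
    cross u (cross v w) = -cross v (cross u w) := by
  have := cross_cross_add u v w
  rw [huv, huw, hvw] at this
  exact eq_neg_of_add_eq_zero_left (by simpa using this)

theorem cross_cross_assoc_of_orthogonal {u v w : R7} (huv : (inner ℝ u v : ℝ) = 0)
    (huw : (inner ℝ u w : ℝ) = 0) (hvw : (inner ℝ v w : ℝ) = 0) :
    cross (cross u v) w = -cross u (cross v w) := by
  rw [cross_swap, cross_cross_of_orthogonal (real_inner_comm u w ▸ huw)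
    (real_inner_comm v w ▸ hvw) huv, cross_swap w v, neg_neg, ← crossLin_apply, map_neg,
    crossLin_apply]

/-! ### Subsets of a manifold with slice charts -/

section Slice

variable {𝕜 : Type*} [NontriviallyNormedField 𝕜]
  {E F G : Type*} [NormedAddCommGroup E] [NormedSpace 𝕜 E] [NormedAddCommGroup F] [NormedSpace 𝕜 F]
  [NormedAddCommGroup G] [NormedSpace 𝕜 G]
  {N : Type*} [TopologicalSpace N] [ChartedSpace G N]

variable (𝕜 E F G) in
/-- Slice charts for a subset `S` of a manifold `N`: around every point of `S` there is a chart of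
`N` in which `S` is the intersection of the target with the linear subspace `E × 0`. -/
structure SliceAtlas (n : ℕ∞ω) (S : Set N) where
  /-- the splitting of the model space -/
  equiv : (E × F) ≃L[𝕜] G
  /-- the chart around a point -/
  chart : S → OpenPartialHomeomorph N G
  mem_source : ∀ x : S, (x : N) ∈ (chart x).source
  mem_maximalAtlas : ∀ x, chart x ∈ IsManifold.maximalAtlas 𝓘(𝕜, G) n N
  mem_iff : ∀ x, ∀ p ∈ (chart x).source, p ∈ S ↔ (equiv.symm (chart x p)).2 = 0

namespace SliceAtlas

variable {n : ℕ∞ω} {S : Set N} (A : SliceAtlas 𝕜 E F G n S)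

theorem equiv_fst_zero (x p : S) (hp : (p : N) ∈ (A.chart x).source) :
    A.equiv ((A.equiv.symm (A.chart x p)).1, 0) = A.chart x p := by
  rw [← (A.mem_iff x p hp).1 p.2, Prod.mk.eta, ContinuousLinearEquiv.apply_symm_apply]

theorem symm_mem (x : S) {u : E} (hu : A.equiv (u, 0) ∈ (A.chart x).target) :
    (A.chart x).symm (A.equiv (u, 0)) ∈ S := by
  rw [A.mem_iff x _ ((A.chart x).map_target hu), (A.chart x).right_inv hu]
  simp

open scoped Classical in
/-- The chart of `S` induced by a slice chart. -/
def subtypeChart (x : S) : OpenPartialHomeomorph S E where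
  toFun p := (A.equiv.symm (A.chart x p)).1
  -- The value `x` is a default outside the target; on the target `symm_mem` selects the first
  -- branch.
  invFun u := if h : (A.chart x).symm (A.equiv (u, 0)) ∈ S then ⟨_, h⟩ else x
  source := Subtype.val ⁻¹' (A.chart x).source
  target := {u | A.equiv (u, 0) ∈ (A.chart x).target}
  map_source' p hp := by
    rw [mem_ofPred_eq, A.equiv_fst_zero x p hp]
    exact (A.chart x).map_source hp
  map_target' u hu := by
    rw [dif_pos (A.symm_mem x hu)]
    exact (A.chart x).map_target hu
  left_inv' p hp := by
    have h : (A.chart x).symm (A.equiv ((A.equiv.symm (A.chart x p)).1, 0)) = p := by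
      rw [A.equiv_fst_zero x p hp, (A.chart x).left_inv hp]
    rw [dif_pos (by rw [h]; exact p.2)]
    exact Subtype.ext h
  right_inv' u hu := by
    rw [dif_pos (A.symm_mem x hu), (A.chart x).right_inv hu]
    simp
  open_source := (A.chart x).open_source.preimage continuous_subtype_val
  open_target := (A.chart x).open_target.preimage (by fun_prop)
  continuousOn_toFun := by
    have : ContinuousOn (fun p : S => A.chart x p) (Subtype.val ⁻¹' (A.chart x).source) :=
      (A.chart x).continuousOn.comp continuous_subtype_val.continuousOn fun _ h => h
    exact (continuous_fst.comp A.equiv.symm.continuous).comp_continuousOn this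
  continuousOn_invFun := by
    rw [Topology.IsInducing.subtypeVal.continuousOn_iff]
    have : ContinuousOn (fun u : E => (A.chart x).symm (A.equiv (u, 0)))
        {u | A.equiv (u, 0) ∈ (A.chart x).target} :=
      (A.chart x).continuousOn_symm.comp (by fun_prop) fun _ h => h
    refine this.congr fun u hu => ?_
    simp only [Function.comp_apply]
    rw [dif_pos (A.symm_mem x hu)]

theorem coe_subtypeChart_symm (x : S) {u : E} (hu : u ∈ (A.subtypeChart x).target) :
    ((A.subtypeChart x).symm u : N) = (A.chart x).symm (A.equiv (u, 0)) := by
  have : (A.subtypeChart x).symm u = ⟨_, A.symm_mem x hu⟩ := dif_pos (A.symm_mem x hu)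
  rw [this]

/-- The charted space structure of a subset with slice charts. -/
@[reducible] def chartedSpace : ChartedSpace E S where
  atlas := range A.subtypeChart
  chartAt := A.subtypeChart
  mem_chart_source x := A.mem_source x
  chart_mem_atlas x := mem_range_self x

/-- A transition map of `S` is one of `N`, restricted to the slice `E × 0` and projected back to
`E`. -/
theorem isManifold : letI := A.chartedSpace; IsManifold 𝓘(𝕜, E) n S := by
  let := A.chartedSpace
  apply isManifold_of_contDiffOn
  rintro _ _ ⟨x, rfl⟩ ⟨y, rfl⟩
  simp only [modelWithCornersSelf_coe, modelWithCornersSelf_coe_symm, preimage_id, range_id,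
    inter_univ, Function.comp_id, Function.id_comp]
  have h1 := (contMDiffOn_of_mem_maximalAtlas (A.mem_maximalAtlas y)).comp'
    (contMDiffOn_symm_of_mem_maximalAtlas (A.mem_maximalAtlas x))
  rw [contMDiffOn_iff_contDiffOn] at h1
  have h2 : ContDiffOn 𝕜 n (fun u : E => (A.equiv.symm (((A.chart y) ∘ (A.chart x).symm)
      (A.equiv (u, 0)))).1) ((A.subtypeChart x).symm.trans (A.subtypeChart y)).source := by
    refine (contDiff_fst.comp A.equiv.symm.contDiff).comp_contDiffOn (h1.comp
      (A.equiv.contDiff.comp (contDiff_id.prodMk contDiff_const)).contDiffOn fun u hu => ?_)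
    refine ⟨hu.1, ?_⟩
    have := hu.2
    change ((A.subtypeChart x).symm u : N) ∈ (A.chart y).source at this
    rwa [A.coe_subtypeChart_symm x hu.1] at this
  refine h2.congr fun u hu => ?_
  change (A.equiv.symm (A.chart y ((A.subtypeChart x).symm u : N))).1 = _
  rw [A.coe_subtypeChart_symm x hu.1]
  rfl

theorem isImmersionOfComplement [IsManifold 𝓘(𝕜, G) n N] : letI := A.chartedSpace
    Manifold.IsImmersionOfComplement F 𝓘(𝕜, E) 𝓘(𝕜, G) n (Subtype.val : S → N) := by
  let := A.chartedSpace
  have := A.isManifold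
  intro x
  refine Manifold.IsImmersionAtOfComplement.mk_of_charts A.equiv (A.subtypeChart x) (A.chart x)
    (A.mem_source x) (A.mem_source x) (IsManifold.chart_mem_maximalAtlas x)
    (A.mem_maximalAtlas x) (fun p hp => hp) fun u hu => ?_
  have hu : u ∈ (A.subtypeChart x).target := by simpa using hu
  change A.chart x ((A.subtypeChart x).symm u : N) = A.equiv (u, 0)
  rw [A.coe_subtypeChart_symm x hu]
  exact (A.chart x).right_inv hu

end SliceAtlas

end Slice

/-! ### The differential of an immersion -/

/-- In the immersion charts `f` reads `u ↦ (u, 0)`, so projecting to the first factor gives a local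
left inverse `r`, differentiable at `f x`; the chain rule for `r ∘ f = id` makes the differential
injective. -/
theorem Manifold.IsImmersionAtOfComplement.mfderiv_injective
    {𝕜 : Type*} [NontriviallyNormedField 𝕜]
    {E F G : Type*} [NormedAddCommGroup E] [NormedSpace 𝕜 E] [NormedAddCommGroup F]
    [NormedSpace 𝕜 F] [NormedAddCommGroup G] [NormedSpace 𝕜 G]
    {M N : Type*} [TopologicalSpace M] [ChartedSpace E M] [TopologicalSpace N] [ChartedSpace G N]
    [IsManifold 𝓘(𝕜, E) 1 M] [IsManifold 𝓘(𝕜, G) 1 N]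
    {n : ℕ∞ω} {f : M → N} {x : M}
    (h : Manifold.IsImmersionAtOfComplement F 𝓘(𝕜, E) 𝓘(𝕜, G) n f x) (hn : n ≠ 0) :
    Function.Injective (mfderiv 𝓘(𝕜, E) 𝓘(𝕜, G) f x) := by
  let φ := h.domChart
  let ψ := h.codChart
  let r : N → M := fun p => φ.symm (h.equiv.symm (ψ p)).1
  have hwr : ∀ p ∈ φ.source, h.equiv.symm (ψ (f p)) = (φ p, 0) := fun p hp => by
    have hp' : φ p ∈ (h.domChart.extend 𝓘(𝕜, E)).target := by
      simpa using φ.map_source hp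
    have := h.writtenInCharts hp'
    rw [ContinuousLinearEquiv.symm_apply_eq, ← Function.comp_apply (f := h.equiv) (g := (·, 0)),
      ← this]
    change _ = ψ (f (φ.symm (φ p)))
    rw [φ.left_inv hp]
  have hrf : r ∘ f =ᶠ[nhds x] id := by
    filter_upwards [φ.open_source.mem_nhds h.mem_domChart_source] with p hp
    change φ.symm (h.equiv.symm (ψ (f p))).1 = p
    rw [hwr p hp, φ.left_inv hp]
  have hf : MDifferentiableAt 𝓘(𝕜, E) 𝓘(𝕜, G) f x := h.contMDiffAt.mdifferentiableAt hn
  have hr : MDifferentiableAt 𝓘(𝕜, G) 𝓘(𝕜, E) r (f x) := by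
    have h1 : MDifferentiableAt 𝓘(𝕜, G) 𝓘(𝕜, G) ψ (f x) :=
      (contMDiffAt_of_mem_maximalAtlas h.codChart_mem_maximalAtlas
        h.mem_codChart_source).mdifferentiableAt hn
    have h2 : MDifferentiableAt 𝓘(𝕜, G) 𝓘(𝕜, E) (fun y : G => (h.equiv.symm y).1) (ψ (f x)) :=
      (((ContinuousLinearMap.fst 𝕜 E F).comp
        (h.equiv.symm : G →L[𝕜] E × F)).differentiableAt).mdifferentiableAt
    have h3 : MDifferentiableAt 𝓘(𝕜, E) 𝓘(𝕜, E) φ.symm (h.equiv.symm (ψ (f x))).1 := by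
      refine (contMDiffAt_symm_of_mem_maximalAtlas h.domChart_mem_maximalAtlas
        ?_).mdifferentiableAt hn
      rw [hwr x h.mem_domChart_source]
      exact φ.map_source h.mem_domChart_source
    exact h3.comp (f x) (h2.comp (f x) h1)
  have hid : (mfderiv 𝓘(𝕜, G) 𝓘(𝕜, E) r (f x)).comp (mfderiv 𝓘(𝕜, E) 𝓘(𝕜, G) f x) =
      mfderiv 𝓘(𝕜, E) 𝓘(𝕜, E) (r ∘ f) x := (mfderiv_comp x hr hf).symm
  rw [hrf.mfderiv_eq] at hid
  intro v w hvw
  have key : ∀ v, mfderiv 𝓘(𝕜, G) 𝓘(𝕜, E) r (f x) (mfderiv 𝓘(𝕜, E) 𝓘(𝕜, G) f x v) = v := by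
    intro v
    have := congrArg (fun L => L v) hid
    rw [mfderiv_id] at this
    exact this
  rw [← key v, hvw, key w]

/-! ### Associative planes -/

namespace OrientedPlane

/-- A positively oriented orthonormal basis of an oriented plane. -/
def frame (L : OrientedPlane) : OrthonormalBasis (Fin 3) ℝ L.plane :=
  L.orientation.finOrthonormalBasis (by norm_num) L.finrank_eq

theorem volumeForm_eq_det (L : OrientedPlane) : L.orientation.volumeForm = L.frame.toBasis.det :=
  L.orientation.volumeForm_robust _ (L.orientation.finOrthonormalBasis_orientation _ _)

theorem volumeForm_frame (L : OrientedPlane) : L.orientation.volumeForm L.frame = 1 := by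
  rw [volumeForm_eq_det]
  simpa using L.frame.toBasis.det_self

/-- Alternating 3-forms on a 3-space form a line, so one triple of nonzero volume decides equality.
-/
theorem isAssociative_iff_apply (L : OrientedPlane) (u : Fin 3 → L.plane)
    (hu : L.orientation.volumeForm u ≠ 0) :
    L.IsAssociative ↔ phi0 (fun i => (u i : R7)) = L.orientation.volumeForm u := by
  constructor
  · intro h
    rw [← h]
    rfl
  · intro h
    have key := (phi0.compLinearMap L.plane.subtype).eq_smul_basis_det L.frame.toBasis
    rw [← volumeForm_eq_det] at key
    have h2 := congrArg (fun f => f u) key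
    change phi0 (fun i => (u i : R7)) = _ * _ at h2
    rw [h] at h2
    unfold IsAssociative
    rw [key, mul_eq_right₀ hu |>.1 h2.symm, one_smul]

theorem inner_frame (L : OrientedPlane) (i j : Fin 3) :
    (inner ℝ (L.frame i : R7) (L.frame j : R7) : ℝ) = if i = j then 1 else 0 := by
  rw [← Submodule.coe_inner]
  exact orthonormal_iff_ite.1 L.frame.orthonormal i j

theorem phi0_coe (f : Fin 3 → R7) : phi0 f = inner ℝ (cross (f 0) (f 1)) (f 2) := by
  rw [inner_cross]
  congr 1
  ext i
  fin_cases i <;> rfl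

/-- The equality case of Cauchy–Schwarz: both sides are unit vectors and their inner product is `φ₀`
of the frame, which is 1. -/
theorem IsAssociative.cross_frame {L : OrientedPlane} (h : L.IsAssociative) :
    cross (L.frame 0) (L.frame 1) = L.frame 2 := by
  have h1 := (L.isAssociative_iff_apply L.frame (by rw [volumeForm_frame]; norm_num)).1 h
  rw [volumeForm_frame, phi0_coe] at h1
  have h2 := inner_cross_cross_self (L.frame 0 : R7) (L.frame 1)
  simp only [inner_frame] at h2
  have h3 := L.inner_frame 2 2
  rw [← sub_eq_zero, ← inner_self_eq_zero (𝕜 := ℝ), inner_sub_left, inner_sub_right,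
    inner_sub_right, h2, h3, h1, real_inner_comm, h1]
  norm_num

theorem cross_zero_two {e : Fin 3 → R7} (he : Orthonormal ℝ e) (h : e 2 = cross (e 0) (e 1)) :
    cross (e 0) (e 2) = -e 1 := by
  have hi := orthonormal_iff_ite.1 he
  rw [h, cross_cross_self, hi, hi]
  simp

theorem cross_one_two {e : Fin 3 → R7} (he : Orthonormal ℝ e) (h : e 2 = cross (e 0) (e 1)) :
    cross (e 1) (e 2) = e 0 := by
  have hi := orthonormal_iff_ite.1 he
  rw [h, cross_swap (e 0), ← crossLin_apply, map_neg, crossLin_apply, cross_cross_self, hi, hi]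
  simp

theorem cross_frame_mem {e : Fin 3 → R7} (he : Orthonormal ℝ e) (h : e 2 = cross (e 0) (e 1))
    {S : Submodule ℝ R7} (hS : ∀ i, e i ∈ S) (i j : Fin 3) : cross (e i) (e j) ∈ S := by
  have key : ∀ i j, i < j → cross (e i) (e j) ∈ S := by
    intro i j hij
    fin_cases i <;> fin_cases j <;> simp at hij
    · exact h ▸ hS 2
    · exact cross_zero_two he h ▸ S.neg_mem (hS 1)
    · exact cross_one_two he h ▸ hS 0
  rcases lt_trichotomy i j with hij | rfl | hij
  · exact key i j hij
  · rw [cross_self_eq_zero]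
    exact S.zero_mem
  · rw [cross_swap]
    exact S.neg_mem (key j i hij)

theorem IsAssociative.cross_mem {L : OrientedPlane} (h : L.IsAssociative) {u v : R7}
    (hu : u ∈ L.plane) (hv : v ∈ L.plane) : cross u v ∈ L.plane := by
  have hon : Orthonormal ℝ fun i => (L.frame i : R7) :=
    orthonormal_iff_ite.2 L.inner_frame
  have hexp : ∀ x : L.plane, (x : R7) = ∑ i, L.frame.repr x i • (L.frame i : R7) := fun x => by
    conv_lhs => rw [← L.frame.sum_repr x]
    simp
  have hu' := hexp ⟨u, hu⟩
  have hv' := hexp ⟨v, hv⟩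
  simp only at hu' hv'
  rw [hu', hv', ← crossLin_apply, map_sum]
  refine L.plane.sum_mem fun j _ => ?_
  rw [map_sum, LinearMap.sum_apply]
  refine L.plane.sum_mem fun i _ => ?_
  rw [map_smul, LinearMap.map_smul, LinearMap.smul_apply]
  exact L.plane.smul_mem _ (L.plane.smul_mem _
    (cross_frame_mem hon h.cross_frame.symm (fun i => (L.frame i).2) i j))

/-- The isomorphism of `ℝ³` with its image under an injective linear map. -/
def rangeEquiv (f : (Fin 3 → ℝ) →ₗ[ℝ] R7) (hf : Function.Injective f) :
    (Fin 3 → ℝ) ≃ₗ[ℝ] (ofInjective f hf).plane :=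
  LinearEquiv.ofInjective f hf

/-- The image of the standard basis under an injective linear map, as a basis of the plane. -/
def rangeBasis (f : (Fin 3 → ℝ) →ₗ[ℝ] R7) (hf : Function.Injective f) :
    Basis (Fin 3) ℝ (ofInjective f hf).plane :=
  (Pi.basisFun ℝ (Fin 3)).map (rangeEquiv f hf)

theorem coe_rangeBasis (f : (Fin 3 → ℝ) →ₗ[ℝ] R7) (hf : Function.Injective f) (i : Fin 3) :
    (rangeBasis f hf i : R7) = f (Pi.single i 1) := by
  rw [rangeBasis, Basis.map_apply, Pi.basisFun_apply]
  rfl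

theorem volumeForm_rangeBasis_pos (f : (Fin 3 → ℝ) →ₗ[ℝ] R7) (hf : Function.Injective f) :
    0 < (ofInjective f hf).orientation.volumeForm (rangeBasis f hf) := by
  rw [volumeForm_eq_det]
  rw [← Basis.orientation_eq_iff_det_pos]
  have h1 : (ofInjective f hf).frame.toBasis.orientation = (ofInjective f hf).orientation :=
    Orientation.finOrthonormalBasis_orientation _ _ _
  rw [h1, rangeBasis, Basis.orientation_map]
  rfl

section AlternatingThree

variable {M : Type*} [AddCommGroup M] [Module ℝ M] (η : M [⋀^Fin 3]→ₗ[ℝ] ℝ)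

theorem alternating_third_combination (a b c : M) (r s t : ℝ) :
    η ![a, b, r • a + s • b + t • c] = t * η ![a, b, c] := by
  have hlin : ∀ y, η ![a, b, y] = (η.toMultilinearMap.toLinearMap ![a, b, 0] 2) y := by
    intro y
    simp only [MultilinearMap.toLinearMap_apply, AlternatingMap.coe_multilinearMap]
    congr 1
    ext j
    fin_cases j <;> simp [Function.update]
  have ha : η ![a, b, a] = 0 := η.map_eq_zero_of_eq _ (i := 0) (j := 2) rfl (by decide)
  have hb : η ![a, b, b] = 0 := η.map_eq_zero_of_eq _ (i := 1) (j := 2) rfl (by decide)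
  rw [hlin, map_add, map_add, map_smul, map_smul, map_smul, ← hlin, ← hlin, ← hlin, ha, hb]
  simp

theorem alternating_second_sub (a b c : M) (t : ℝ) :
    η ![a, b - t • a, c] = η ![a, b, c] := by
  have hlin : ∀ y, η ![a, y, c] = (η.toMultilinearMap.toLinearMap ![a, 0, c] 1) y := by
    intro y
    simp only [MultilinearMap.toLinearMap_apply, AlternatingMap.coe_multilinearMap]
    congr 1
    ext j
    fin_cases j <;> simp [Function.update]
  have ha : η ![a, a, c] = 0 := η.map_eq_zero_of_eq _ (i := 0) (j := 1) rfl (by decide)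
  rw [hlin, map_sub, map_smul, ← hlin, ← hlin, ha]
  simp

end AlternatingThree

/-- The span of `u₀, u₁, u₂` with this orientation is associative if and only if `u₀ × u₁` belongs
to it and has a positive component along `u₂`. -/
theorem isAssociative_ofInjective_iff (f : (Fin 3 → ℝ) →ₗ[ℝ] R7) (hf : Function.Injective f) :
    (ofInjective f hf).IsAssociative ↔
      ∃ x : Fin 3 → ℝ, f x = cross (f (Pi.single 0 1)) (f (Pi.single 1 1)) ∧ 0 < x 2 := by
  set L := ofInjective f hf with hL
  set u := rangeBasis f hf with hu
  set vol := L.orientation.volumeForm with hvoldef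
  have hpos : 0 < vol u := volumeForm_rangeBasis_pos f hf
  set c := cross (f (Pi.single 0 1)) (f (Pi.single 1 1)) with hc
  have hexp : ∀ x, f x = x 0 • f (Pi.single 0 1) + x 1 • f (Pi.single 1 1)
      + x 2 • f (Pi.single 2 1) := by
    intro x
    rw [← map_smul, ← map_smul, ← map_smul, ← map_add, ← map_add]
    congr 1
    ext i
    fin_cases i <;> simp
  have hinj : ∀ a b : ℝ, a • f (Pi.single 0 1) + b • f (Pi.single 1 1) = 0 → a = 0 ∧ b = 0 := by
    intro a b hab
    have h0 : f ![a, b, 0] = 0 := by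
      rw [hexp]
      simpa using hab
    have := hf (h0.trans (map_zero f).symm)
    exact ⟨congrFun this 0, congrFun this 1⟩
  -- If `u₀ × u₁ = 0`, then `u₀ × (u₀ × u₁) = 0` is a linear relation between `u₀` and `u₁` with
  -- coefficient `-|u₀|²` on `u₁`.
  have hcross0 : c ≠ 0 := by
    intro h0
    have h1 : cross (f (Pi.single 0 1)) c = 0 := by
      rw [h0, ← crossLin_apply, map_zero]
    rw [hc, cross_cross_self, sub_eq_add_neg, ← neg_smul] at h1
    have h2 := (hinj _ _ h1).2
    rw [neg_eq_zero, inner_self_eq_zero] at h2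
    have := (hinj 1 0 (by rw [h2]; simp)).1
    norm_num at this
  have hcc : 0 < (inner ℝ c c : ℝ) := real_inner_self_pos.2 hcross0
  have hvol : ∀ x (hx : f x ∈ L.plane), vol ![u 0, u 1, ⟨f x, hx⟩] = x 2 * vol u := by
    intro x hx
    have h1 : (⟨f x, hx⟩ : L.plane) = x 0 • u 0 + x 1 • u 1 + x 2 • u 2 := by
      apply Subtype.ext
      simp only [Submodule.coe_add, Submodule.coe_smul, hu, coe_rangeBasis]
      exact hexp x
    have h2 : (u : Fin 3 → L.plane) = ![u 0, u 1, u 2] := by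
      ext i
      fin_cases i <;> rfl
    rw [h1, alternating_third_combination, ← h2]
  have hu0 : (u 0 : R7) = f (Pi.single 0 1) := coe_rangeBasis f hf 0
  have hu1 : (u 1 : R7) = f (Pi.single 1 1) := coe_rangeBasis f hf 1
  constructor
  · intro h
    have hmem : c ∈ L.plane :=
      h.cross_mem (LinearMap.mem_range_self _ _) (LinearMap.mem_range_self _ _)
    obtain ⟨x, hx⟩ := LinearMap.mem_range.1 hmem
    refine ⟨x, hx, ?_⟩
    have h1 := hvol x (hx ▸ hmem)
    -- The volume of `(u₀, u₁, c)` equals `φ₀(u₀, u₁, c) = |c|² > 0` and also `x₂ · vol u`, so `x₂`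
    -- is positive.
    have h2 : vol ![u 0, u 1, ⟨f x, hx ▸ hmem⟩] = inner ℝ c c := by
      rw [hvoldef, ← h]
      change phi0 (fun i => ((![u 0, u 1, ⟨f x, hx ▸ hmem⟩] : Fin 3 → L.plane) i : R7)) = _
      rw [phi0_coe]
      change inner ℝ (cross (u 0 : R7) (u 1 : R7)) (f x) = _
      rw [hu0, hu1, hx]
    rw [h2] at h1
    by_contra hle
    have := mul_nonpos_of_nonpos_of_nonneg (not_lt.1 hle) hpos.le
    linarith
  · rintro ⟨x, hx, hx2⟩
    have hmem : f x ∈ L.plane := LinearMap.mem_range_self _ _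
    have hu00 : (inner ℝ (u 0 : R7) (u 0 : R7) : ℝ) ≠ 0 := by
      rw [Ne, inner_self_eq_zero, hu0]
      intro h0
      have := (hinj 1 0 (by rw [h0]; simp)).1
      norm_num at this
    -- One Gram–Schmidt step: removing from `u₁` its component along `u₀` changes neither the cross
    -- product nor the volume, and makes the triple `v` orthogonal. Its volume is then the product
    -- of the lengths, which is also the value of `φ₀`.
    set t : ℝ := inner ℝ (u 0 : R7) (u 1 : R7) / inner ℝ (u 0 : R7) (u 0 : R7) with ht
    set v : Fin 3 → L.plane := ![u 0, u 1 - t • u 0, ⟨f x, hmem⟩] with hv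
    have h01 : (inner ℝ (u 0 : R7) ((u 1 : R7) - t • (u 0 : R7)) : ℝ) = 0 := by
      rw [inner_sub_right, inner_smul_right, ht, div_mul_cancel₀ _ hu00, sub_self]
    have hcr : cross (u 0 : R7) ((u 1 : R7) - t • (u 0 : R7)) = c := by
      rw [← crossLin_apply, map_sub, map_smul, crossLin_apply, crossLin_apply, cross_self_eq_zero,
        smul_zero, sub_zero, hu0, hu1]
    have hfx : f x = cross (u 0 : R7) ((u 1 : R7) - t • (u 0 : R7)) := by rw [hcr, hx]
    have hpair : Pairwise fun i j => (inner ℝ (v i) (v j) : ℝ) = 0 := by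
      have hlt : ∀ i j, i < j → (inner ℝ (v i) (v j) : ℝ) = 0 := by
        intro i j hij
        rw [Submodule.coe_inner]
        fin_cases i <;> fin_cases j <;> simp at hij
        · exact h01
        · change (inner ℝ (u 0 : R7) (f x) : ℝ) = 0
          rw [hfx, inner_cross_left]
        · change (inner ℝ ((u 1 : R7) - t • (u 0 : R7)) (f x) : ℝ) = 0
          rw [hfx, inner_cross_right]
      intro i j hij
      rcases lt_or_gt_of_ne hij with h | h
      · exact hlt i j h
      · exact (real_inner_comm _ _).trans (hlt j i h)
    have hvpos : 0 < vol v := by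
      rw [hv, alternating_second_sub, hvol x hmem]
      exact mul_pos hx2 hpos
    have hprod := L.orientation.abs_volumeForm_apply_of_pairwise_orthogonal hpair
    rw [abs_of_pos hvpos, Fin.prod_univ_three] at hprod
    rw [L.isAssociative_iff_apply v hvpos.ne', hprod, phi0_coe]
    change (inner ℝ (cross (u 0 : R7) ((u 1 : R7) - t • (u 0 : R7))) (f x) : ℝ) =
      ‖(u 0 : R7)‖ * ‖(u 1 : R7) - t • (u 0 : R7)‖ * ‖f x‖
    have hnorm : ‖f x‖ = ‖(u 0 : R7)‖ * ‖(u 1 : R7) - t • (u 0 : R7)‖ := by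
      have := inner_cross_cross_self (u 0 : R7) ((u 1 : R7) - t • (u 0 : R7))
      rw [h01, ← hfx, real_inner_self_eq_norm_sq, real_inner_self_eq_norm_sq,
        real_inner_self_eq_norm_sq] at this
      rw [← sq_eq_sq₀ (norm_nonneg _) (by positivity), this]
      ring
    rw [← hfx, ← hnorm, real_inner_self_eq_norm_mul_norm]

end OrientedPlane

/-! ### Slice charts for the associative planes -/

/-- The cross product as a continuous bilinear map. -/
def crossCLM : R7 →L[ℝ] R7 →L[ℝ] R7 := crossLin.toContinuousBilinearMap

theorem crossCLM_apply (u v : R7) : crossCLM u v = cross u v := rfl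

theorem ContDiff.cross {X : Type*} [NormedAddCommGroup X] [NormedSpace ℝ X] {n : ℕ∞ω}
    {f g : X → R7} (hf : ContDiff ℝ n f) (hg : ContDiff ℝ n g) :
    ContDiff ℝ n fun x => cross (f x) (g x) :=
  (crossCLM.contDiff.comp hf).clm_apply hg

namespace OrientedPlane

/-- The chart of `G(3,7)` given by a splitting, as a partial homeomorphism. -/
def graphHomeo (b : Splitting) : OpenPartialHomeomorph OrientedPlane Model :=
  core.openPartialHomeomorph (graphChart b) (mem_range_self b)

theorem graphHomeo_mem_maximalAtlas (b : Splitting) (n : ℕ∞ω) :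
    graphHomeo b ∈ IsManifold.maximalAtlas 𝓘(ℝ, Model) n OrientedPlane :=
  IsManifold.subset_maximalAtlas
    (mem_iUnion₂.2 ⟨graphChart b, mem_range_self b, mem_singleton _⟩)

theorem graph_graphHomeo (b : Splitting) {L : OrientedPlane} (hL : L ∈ (graphHomeo b).source) :
    graph b (graphHomeo b L) = L :=
  (graphHomeo b).left_inv hL

/-- The cross product of the first two standard spanning vectors of the graph of `A`, in the
coordinates of the splitting. -/
def crossGraph (b : Splitting) (A : Model) : (Fin 3 → ℝ) × (Fin 4 → ℝ) :=
  b.symm (cross (b (Pi.single 0 1, A (Pi.single 0 1))) (b (Pi.single 1 1, A (Pi.single 1 1))))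

/-- If the graph of `A` is associative, then `A` sends the third standard basis vector to this
function of the images of the first two. -/
def thirdImage (b : Splitting) (A : Model) : Fin 4 → ℝ :=
  ((crossGraph b A).1 2)⁻¹ • ((crossGraph b A).2 - (crossGraph b A).1 0 • A (Pi.single 0 1)
    - (crossGraph b A).1 1 • A (Pi.single 1 1))

theorem apply_eq_sum_single (A : Model) (x : Fin 3 → ℝ) : A x = x 0 • A (Pi.single 0 1) +
    x 1 • A (Pi.single 1 1) + x 2 • A (Pi.single 2 1) := by
  rw [← map_smul, ← map_smul, ← map_smul, ← map_add, ← map_add]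
  congr 1
  ext i
  fin_cases i <;> simp

/-- Membership of the cross product in the graph forces `x` to be the first component of `crossGraph
b A`; the second component is a linear equation for the image of the third basis vector, solvable
because its coefficient is positive. -/
theorem isAssociative_graph_iff (b : Splitting) (A : Model) : (graph b A).IsAssociative ↔
    0 < (crossGraph b A).1 2 ∧ A (Pi.single 2 1) = thirdImage b A := by
  have hx : ∀ x, graphMap b A x = cross (graphMap b A (Pi.single 0 1))
      (graphMap b A (Pi.single 1 1)) ↔ (x, A x) = crossGraph b A := fun x => by
    rw [crossGraph, ContinuousLinearEquiv.eq_symm_apply]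
    rfl
  rw [graph, isAssociative_ofInjective_iff]
  simp only [hx]
  constructor
  · rintro ⟨x, hx, hpos⟩
    rw [thirdImage, ← hx]
    refine ⟨hpos, ?_⟩
    rw [eq_inv_smul_iff₀ hpos.ne', apply_eq_sum_single A x]
    module
  · rintro ⟨hpos, h⟩
    refine ⟨(crossGraph b A).1, Prod.ext rfl ?_, hpos⟩
    change A _ = _
    rw [apply_eq_sum_single, h, thirdImage, smul_inv_smul₀ hpos.ne']
    module

theorem contDiff_crossGraph (b : Splitting) {n : ℕ∞ω} : ContDiff ℝ n (crossGraph b) := by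
  refine b.symm.contDiff.comp (ContDiff.cross ?_ ?_) <;>
  exact b.contDiff.comp (contDiff_const.prodMk (contDiff_id.clm_apply contDiff_const))

theorem contDiffOn_thirdImage (b : Splitting) {n : ℕ∞ω} :
    ContDiffOn ℝ n (thirdImage b) {A | 0 < (crossGraph b A).1 2} := by
  have h : ∀ i, ContDiff ℝ n fun A => (crossGraph b A).1 i := fun i =>
    contDiff_pi.1 (contDiff_fst.comp (contDiff_crossGraph b)) i
  refine ((h 2).contDiffOn.inv fun A hA => (ne_of_gt hA)).smul (ContDiff.contDiffOn ?_)
  have hA : ∀ x : Fin 3 → ℝ, ContDiff ℝ n fun A : Model => A x := fun x =>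
    contDiff_id.clm_apply contDiff_const
  exact ((contDiff_snd.comp (contDiff_crossGraph b)).sub ((h 0).smul (hA _))).sub
    ((h 1).smul (hA _))

/-- The homomorphism which sends the third standard basis vector to `c` and kills the others. -/
def thirdHom : (Fin 4 → ℝ) →L[ℝ] Model :=
  ContinuousLinearMap.smulRightL ℝ _ _ (ContinuousLinearMap.proj 2)

theorem thirdHom_apply (c : Fin 4 → ℝ) (x : Fin 3 → ℝ) : thirdHom c x = x 2 • c := rfl

/-- Only the images of the first two basis vectors enter. This is why the shear preserves its domain
and is inverted by changing a sign. -/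
theorem crossGraph_add_thirdHom (b : Splitting) (A : Model) (c : Fin 4 → ℝ) :
    crossGraph b (A + thirdHom c) = crossGraph b A := by
  simp [crossGraph, thirdHom_apply]

theorem thirdImage_add_thirdHom (b : Splitting) (A : Model) (c : Fin 4 → ℝ) :
    thirdImage b (A + thirdHom c) = thirdImage b A := by
  simp [thirdImage, crossGraph_add_thirdHom, thirdHom_apply]

theorem crossGraph_sub_thirdHom (b : Splitting) (A : Model) (c : Fin 4 → ℝ) :
    crossGraph b (A - thirdHom c) = crossGraph b A := by
  rw [sub_eq_add_neg, ← map_neg, crossGraph_add_thirdHom]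

theorem thirdImage_sub_thirdHom (b : Splitting) (A : Model) (c : Fin 4 → ℝ) :
    thirdImage b (A - thirdHom c) = thirdImage b A := by
  rw [sub_eq_add_neg, ← map_neg, thirdImage_add_thirdHom]

theorem contDiffOn_sub_thirdImage (b : Splitting) {n : ℕ∞ω} :
    ContDiffOn ℝ n (fun A => A - thirdHom (thirdImage b A)) {A | 0 < (crossGraph b A).1 2} :=
  contDiffOn_id.sub (thirdHom.contDiff.comp_contDiffOn (contDiffOn_thirdImage b))

theorem contDiffOn_add_thirdImage (b : Splitting) {n : ℕ∞ω} :
    ContDiffOn ℝ n (fun A => A + thirdHom (thirdImage b A)) {A | 0 < (crossGraph b A).1 2} :=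
  contDiffOn_id.add (thirdHom.contDiff.comp_contDiffOn (contDiffOn_thirdImage b))

theorem isOpen_crossGraph_pos (b : Splitting) : IsOpen {A | 0 < (crossGraph b A).1 2} :=
  isOpen_lt continuous_const ((continuous_apply 2).comp
    (continuous_fst.comp (contDiff_crossGraph b (n := 0)).continuous))

/-- The shear of `Hom(ℝ³, ℝ⁴)` which straightens the associative planes. -/
def shear (b : Splitting) : OpenPartialHomeomorph Model Model where
  toFun A := A - thirdHom (thirdImage b A)
  invFun A := A + thirdHom (thirdImage b A)
  source := {A | 0 < (crossGraph b A).1 2}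
  target := {A | 0 < (crossGraph b A).1 2}
  map_source' A hA := by
    rwa [mem_ofPred_eq, crossGraph_sub_thirdHom]
  map_target' A hA := by
    rwa [mem_ofPred_eq, crossGraph_add_thirdHom]
  left_inv' A hA := by
    rw [thirdImage_sub_thirdHom, sub_add_cancel]
  right_inv' A hA := by
    rw [thirdImage_add_thirdHom, add_sub_cancel_right]
  open_source := isOpen_crossGraph_pos b
  open_target := isOpen_crossGraph_pos b
  continuousOn_toFun := (contDiffOn_sub_thirdImage b (n := 0)).continuousOn
  continuousOn_invFun := (contDiffOn_add_thirdImage b (n := 0)).continuousOn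

/-- A chart of `G(3,7)` in which the associative planes form a linear subspace. -/
def straightChart (b : Splitting) : OpenPartialHomeomorph OrientedPlane Model :=
  (graphHomeo b).trans (shear b)

theorem straightChart_mem_maximalAtlas (b : Splitting) (n : ℕ∞ω) :
    straightChart b ∈ IsManifold.maximalAtlas 𝓘(ℝ, Model) n OrientedPlane := by
  have hg := graphHomeo_mem_maximalAtlas b n
  apply OpenPartialHomeomorph.mem_maximalAtlas_of_contMDiffOn
  · refine (contMDiffOn_iff_contDiffOn.2 (contDiffOn_sub_thirdImage b)).comp
      ((contMDiffOn_of_mem_maximalAtlas hg).mono fun L hL => hL.1) fun L hL => hL.2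
  · refine (contMDiffOn_symm_of_mem_maximalAtlas hg).comp
      ((contMDiffOn_iff_contDiffOn.2 (contDiffOn_add_thirdImage b)).mono fun A hA => hA.1)
      fun A hA => mem_univ _

theorem isAssociative_iff_straightChart (b : Splitting) {L : OrientedPlane}
    (hL : L ∈ (straightChart b).source) :
    L.IsAssociative ↔ straightChart b L (Pi.single 2 1) = 0 := by
  have h1 : L ∈ (graphHomeo b).source := hL.1
  have h2 : 0 < (crossGraph b (graphHomeo b L)).1 2 := hL.2
  conv_lhs => rw [← graph_graphHomeo b h1]
  rw [isAssociative_graph_iff, and_iff_right h2]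
  change _ ↔ (graphHomeo b L - thirdHom (thirdImage b (graphHomeo b L))) (Pi.single 2 1) = 0
  rw [sub_apply, thirdHom_apply, Pi.single_eq_same, one_smul, sub_eq_zero]

/-- Restricting the graph chart to the domain of the shear loses no associative plane, since
positivity is part of the criterion. -/
theorem mem_straightChart_source (b : Splitting) {L : OrientedPlane}
    (hL : L ∈ (graphHomeo b).source) (ha : L.IsAssociative) : L ∈ (straightChart b).source := by
  refine ⟨hL, ?_⟩
  rw [← graph_graphHomeo b hL, isAssociative_graph_iff] at ha
  exact ha.1

/-- The images of the standard basis vectors, as linear coordinates on `Hom(ℝ³, ℝ⁴)`. -/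
def imagesEquiv : Model ≃ₗ[ℝ] ((Fin 4 → ℝ) × (Fin 4 → ℝ)) × (Fin 4 → ℝ) :=
  LinearEquiv.ofBijective
    { toFun := fun A => ((A (Pi.single 0 1), A (Pi.single 1 1)), A (Pi.single 2 1))
      map_add' := fun _ _ => rfl
      map_smul' := fun _ _ => rfl } <| by
    constructor
    · intro A B h
      simp only [LinearMap.coe_mk, AddHom.coe_mk, Prod.mk.injEq] at h
      ext1 x
      rw [apply_eq_sum_single A, apply_eq_sum_single B, h.1.1, h.1.2, h.2]
    · rintro ⟨⟨p, q⟩, r⟩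
      refine ⟨(ContinuousLinearMap.proj 0).smulRight p + (ContinuousLinearMap.proj 1).smulRight q
        + (ContinuousLinearMap.proj 2).smulRight r, ?_⟩
      simp

/-- The splitting of `Hom(ℝ³, ℝ⁴)` into the images of the first two basis vectors and that of the
third one. -/
def modelEquiv : (EuclideanSpace ℝ (Fin 8) × (Fin 4 → ℝ)) ≃L[ℝ] Model :=
  -- Any identification `ℝ⁸ ≅ ℝ⁴ × ℝ⁴` serves: the slice condition only involves the last factor.
  (((LinearEquiv.ofFinrankEq (EuclideanSpace ℝ (Fin 8)) ((Fin 4 → ℝ) × (Fin 4 → ℝ))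
    (by simp)).prodCongr (LinearEquiv.refl ℝ (Fin 4 → ℝ))).trans
      imagesEquiv.symm).toContinuousLinearEquiv

theorem modelEquiv_symm_snd (A : Model) : (modelEquiv.symm A).2 = A (Pi.single 2 1) := by
  rfl

/-- The slice charts of `G(3,7)` for the set of associative planes. -/
def assocSliceAtlas : SliceAtlas ℝ (EuclideanSpace ℝ (Fin 8)) (Fin 4 → ℝ) Model ∞
    {L : OrientedPlane | L.IsAssociative} where
  equiv := modelEquiv
  chart L := straightChart (exists_mem_graphChart_source L.1).choose
  mem_source L := mem_straightChart_source _ (exists_mem_graphChart_source L.1).choose_spec L.2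
  mem_maximalAtlas L := straightChart_mem_maximalAtlas _ _
  mem_iff L p hp := by
    rw [modelEquiv_symm_snd]
    exact isAssociative_iff_straightChart _ hp

end OrientedPlane

/-! ### The orthogonal projection onto the range of an injective map -/

section RangeProjection

variable {X Y : Type*} [NormedAddCommGroup X] [InnerProductSpace ℝ X] [FiniteDimensional ℝ X]
  [NormedAddCommGroup Y] [InnerProductSpace ℝ Y] [CompleteSpace Y]

open ContinuousLinearMap in
theorem exists_equiv_adjoint_comp_self [CompleteSpace X] (M : X →L[ℝ] Y)
    (hM : Function.Injective M) : ∃ g : X ≃L[ℝ] X, (g : X →L[ℝ] X) = (adjoint M).comp M := by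
  have hinj : Function.Injective ((adjoint M).comp M).toLinearMap := by
    rw [injective_iff_map_eq_zero]
    intro x hx
    have h1 : (inner ℝ (M x) (M x) : ℝ) = 0 := by
      rw [← adjoint_inner_right]
      change inner ℝ x (((adjoint M).comp M).toLinearMap x) = 0
      rw [hx, inner_zero_right]
    exact hM ((inner_self_eq_zero.1 h1).trans (map_zero M).symm)
  refine ⟨(LinearEquiv.ofInjectiveEndo _ hinj).toContinuousLinearEquiv, ?_⟩
  ext x
  rfl

open ContinuousLinearMap in
-- The normal equations of least squares. The formula exhibits the projection as a smooth function
-- of `M`.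
theorem starProjection_range_eq [CompleteSpace X] (M : X →L[ℝ] Y) (hM : Function.Injective M) :
    M.range.starProjection = M.comp (((adjoint M).comp M).inverse.comp (adjoint M)) := by
  obtain ⟨g, hg⟩ := exists_equiv_adjoint_comp_self M hM
  rw [← hg, inverse_equiv]
  ext y
  refine Submodule.eq_starProjection_of_mem_of_inner_eq_zero ⟨_, rfl⟩ ?_
  rintro _ ⟨x, rfl⟩
  change inner ℝ (y - M (g.symm (adjoint M y))) (M x) = 0
  rw [← adjoint_inner_left, map_sub]
  have : adjoint M (M (g.symm (adjoint M y))) = g (g.symm (adjoint M y)) := by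
    rw [← ContinuousLinearEquiv.coe_coe g, hg]
    rfl
  rw [this, g.apply_symm_apply, sub_self, inner_zero_left]

end RangeProjection

namespace OrientedPlane

/-- The embedding of `ℝ³` onto the graph of `A`, as a map of Euclidean spaces. -/
def graphCLM (b : Splitting) (A : Model) : EuclideanSpace ℝ (Fin 3) →L[ℝ] R7 :=
  (b : _ →L[ℝ] R7).comp (((ContinuousLinearMap.id ℝ _).prod A).comp
    (EuclideanSpace.equiv (Fin 3) ℝ : _ →L[ℝ] _))

theorem contDiff_graphCLM (b : Splitting) {n : ℕ∞ω} : ContDiff ℝ n (graphCLM b) :=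
  contDiff_const.clm_comp (contDiff_id_prod.clm_comp contDiff_const)

theorem graphCLM_injective (b : Splitting) (A : Model) : Function.Injective (graphCLM b A) :=
  (graphMap_injective b A).comp (EuclideanSpace.equiv (Fin 3) ℝ).injective

theorem range_graphCLM (b : Splitting) (A : Model) : (graphCLM b A).range = (graph b A).plane := by
  ext y
  constructor
  · rintro ⟨x, rfl⟩
    exact ⟨EuclideanSpace.equiv (Fin 3) ℝ x, rfl⟩
  · rintro ⟨x, rfl⟩
    exact ⟨(EuclideanSpace.equiv (Fin 3) ℝ).symm x, rfl⟩

open ContinuousLinearMap in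
theorem contDiff_proj_graph (b : Splitting) {n : ℕ∞ω} :
    ContDiff ℝ n fun A => proj (graph b A) := by
  -- Checked on matrix entries, which are inner products with the images of the basis vectors.
  have hadj : ContDiff ℝ n fun A => adjoint (graphCLM b A) := by
    rw [contDiff_clm_apply_iff]
    intro y
    rw [contDiff_euclidean]
    intro i
    have : ∀ A, adjoint (graphCLM b A) y i =
        inner ℝ (graphCLM b A (EuclideanSpace.single i 1)) y := fun A => by
      rw [← adjoint_inner_right, EuclideanSpace.inner_single_left]
      simp
    simp only [this]
    exact ((contDiff_graphCLM b).clm_apply contDiff_const).inner ℝ contDiff_const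
  have hinv : ContDiff ℝ n fun A => ((adjoint (graphCLM b A)).comp (graphCLM b A)).inverse := by
    rw [contDiff_iff_contDiffAt]
    intro A
    obtain ⟨g, hg⟩ := exists_equiv_adjoint_comp_self _ (graphCLM_injective b A)
    refine ContDiffAt.comp (g := inverse)
      (f := fun A => (adjoint (graphCLM b A)).comp (graphCLM b A)) A ?_
      (hadj.clm_comp (contDiff_graphCLM b)).contDiffAt
    rw [← hg]
    exact contDiffAt_map_inverse g
  have : (fun A => proj (graph b A)) = fun A => (graphCLM b A).comp
      (((adjoint (graphCLM b A)).comp (graphCLM b A)).inverse.comp (adjoint (graphCLM b A))) := by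
    funext A
    rw [← starProjection_range_eq _ (graphCLM_injective b A), proj]
    simp only [range_graphCLM]
  rw [this]
  exact (contDiff_graphCLM b).clm_comp (hinv.clm_comp hadj)

theorem contMDiff_proj {n : ℕ∞ω} : ContMDiff 𝓘(ℝ, Model) 𝓘(ℝ, R7 →L[ℝ] R7) n proj := by
  intro L
  obtain ⟨b, hb⟩ := exists_mem_graphChart_source L
  have hb : L ∈ (graphHomeo b).source := hb
  have h1 : ContMDiffAt 𝓘(ℝ, Model) 𝓘(ℝ, R7 →L[ℝ] R7) n
      ((fun A => proj (graph b A)) ∘ graphHomeo b) L :=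
    ContMDiffAt.comp L (contDiff_proj_graph b).contMDiff.contMDiffAt
      (contMDiffAt_of_mem_maximalAtlas (graphHomeo_mem_maximalAtlas b n) hb)
  refine h1.congr_of_eventuallyEq ?_
  filter_upwards [(graphHomeo b).open_source.mem_nhds hb] with L' hL'
  rw [Function.comp_apply, graph_graphHomeo b hL']

/-! ### The differential of the projection -/

/-- The splitting which defines the preferred chart at `L`. -/
def splittingAt (L : OrientedPlane) : Splitting := (exists_mem_graphChart_source L).choose

/-- The coordinate of `L` in its preferred chart. -/
def coordAt (L : OrientedPlane) : Model := graphHomeo (splittingAt L) L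

theorem graph_coordAt (L : OrientedPlane) : graph (splittingAt L) (coordAt L) = L :=
  graph_graphHomeo _ (exists_mem_graphChart_source L).choose_spec

/-- In the preferred chart a tangent vector at `L` is simply an element of `Model`, which makes the
differential computable. -/
theorem dproj_eq_fderiv (L : OrientedPlane) :
    dproj L = fderiv ℝ (fun A => proj (graph (splittingAt L) A)) (coordAt L) := by
  have h : MDifferentiableAt 𝓘(ℝ, Model) 𝓘(ℝ, R7 →L[ℝ] R7) proj L :=
    (contMDiff_proj (n := 1)).mdifferentiable one_ne_zero L
  rw [dproj, h.mfderiv, ModelWithCorners.range_eq_univ, fderivWithin_univ]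
  rfl

theorem mem_plane_iff (L : OrientedPlane) (u : R7) :
    u ∈ L.plane ↔ ∃ x, u = splittingAt L (x, coordAt L x) := by
  conv_lhs => rw [← graph_coordAt L]
  constructor
  · rintro ⟨x, rfl⟩
    exact ⟨x, rfl⟩
  · rintro ⟨x, rfl⟩
    exact ⟨x, rfl⟩

theorem proj_of_mem {L : OrientedPlane} {u : R7} (hu : u ∈ L.plane) : proj L u = u :=
  Submodule.starProjection_eq_self_iff.2 hu

theorem proj_of_mem_orthogonal {L : OrientedPlane} {u : R7} (hu : u ∈ L.V) : proj L u = 0 :=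
  (Submodule.starProjection_apply_eq_zero_iff _).2 hu

theorem sub_proj_mem (L : OrientedPlane) (u : R7) : u - proj L u ∈ L.V :=
  Submodule.sub_starProjection_mem_orthogonal u

/-- Differentiate `P_B (b (x, B x)) = b (x, B x)` in `B`, where `P_B` is the projection onto the
graph of `B`. -/
theorem dproj_apply_splittingAt (L : OrientedPlane) (ξ : TangentSpace 𝓘(ℝ, Model) L)
    (x : Fin 3 → ℝ) : dproj L ξ (splittingAt L (x, coordAt L x)) =
      splittingAt L (0, (show Model from ξ) x) -
        proj L (splittingAt L (0, (show Model from ξ) x)) := by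
  set b := splittingAt L
  set A := coordAt L with hA
  have hP : HasFDerivAt (fun A => proj (graph b A)) (dproj L) A := by
    rw [dproj_eq_fderiv]
    exact ((contDiff_proj_graph b (n := 1)).differentiable one_ne_zero _).hasFDerivAt
  let u' : Model →L[ℝ] R7 := (b : _ →L[ℝ] R7).comp
    ((ContinuousLinearMap.inr ℝ (Fin 3 → ℝ) (Fin 4 → ℝ)).comp
      (ContinuousLinearMap.apply ℝ (Fin 4 → ℝ) x))
  have hu : HasFDerivAt (fun B : Model => b (x, B x)) u' A := by
    have : (fun B : Model => b (x, B x)) = fun B => b (x, 0) + u' B := by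
      funext B
      change _ = b (x, 0) + b (0, B x)
      rw [← map_add]
      simp
    rw [this]
    exact u'.hasFDerivAt.const_add _
  have h1 := hP.clm_apply hu
  have h2 : (fun B : Model => proj (graph b B) (b (x, B x))) = fun B => b (x, B x) := by
    funext B
    exact proj_of_mem ⟨x, rfl⟩
  rw [h2] at h1
  have h3 := congrArg (fun f : Model →L[ℝ] R7 => f ξ) (h1.unique hu)
  have hL : graph b A = L := graph_coordAt L
  rw [hL] at h3
  exact eq_sub_of_add_eq' h3

theorem dproj_mem {L : OrientedPlane} (ξ : TangentSpace 𝓘(ℝ, Model) L) {u : R7}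
    (hu : u ∈ L.plane) : dproj L ξ u ∈ L.V := by
  obtain ⟨x, rfl⟩ := (mem_plane_iff L u).1 hu
  rw [dproj_apply_splittingAt]
  exact sub_proj_mem L _

theorem coe_tangentToHom (L : OrientedPlane) (ξ : TangentSpace 𝓘(ℝ, Model) L) (u : L.E) :
    (tangentToHom L ξ u : R7) = dproj L ξ u :=
  Submodule.starProjection_eq_self_iff.2 (dproj_mem ξ u.2)

/-- If `ξ` acts by zero, each `b (0, ξ x)` lies in the graph of the coordinate of `L`, which meets
`0 × ℝ⁴` only in zero. -/
theorem tangentToHom_injective (L : OrientedPlane) : Function.Injective (tangentToHom L) := by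
  rw [injective_iff_map_eq_zero]
  intro ξ hξ
  refine ContinuousLinearMap.ext fun x => ?_
  have hmem : splittingAt L (x, coordAt L x) ∈ L.plane := (mem_plane_iff L _).2 ⟨x, rfl⟩
  have h1 := coe_tangentToHom L ξ ⟨_, hmem⟩
  rw [hξ] at h1
  have h2 : dproj L ξ (splittingAt L (x, coordAt L x)) = 0 := h1.symm
  rw [dproj_apply_splittingAt, sub_eq_zero, eq_comm] at h2
  obtain ⟨y, hy⟩ := (mem_plane_iff L _).1 (Submodule.starProjection_eq_self_iff.1 h2)
  have h3 := (splittingAt L).injective hy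
  rw [Prod.mk.injEq] at h3
  rw [← h3.1, map_zero] at h3
  exact h3.2

theorem finrank_model : finrank ℝ Model = 12 := by
  rw [imagesEquiv.finrank_eq]
  simp

theorem finrank_V (L : OrientedPlane) : finrank ℝ L.V = 4 := by
  have := L.plane.finrank_add_finrank_orthogonal
  rw [L.finrank_eq, finrank_euclideanSpace_fin] at this
  exact Nat.add_left_cancel (this.trans (by norm_num : 7 = 3 + 4))

instance (L : OrientedPlane) : FiniteDimensional ℝ (TangentSpace 𝓘(ℝ, Model) L) :=
  inferInstanceAs (FiniteDimensional ℝ Model)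

theorem finrank_tangentSpace (L : OrientedPlane) :
    finrank ℝ (TangentSpace 𝓘(ℝ, Model) L) = 12 := finrank_model

theorem tangentToHom_bijective (L : OrientedPlane) : Function.Bijective (tangentToHom L) := by
  refine ⟨tangentToHom_injective L, ?_⟩
  refine (LinearMap.injective_iff_surjective_of_finrank_eq_finrank ?_).1 (tangentToHom_injective L)
  rw [finrank_tangentSpace, finrank_linearMap, finrank_V, L.finrank_eq]

theorem tangentToTensor_bijective (L : OrientedPlane) : Function.Bijective (tangentToTensor L) :=
  (dualTensorHomEquiv ℝ L.E L.V).symm.bijective.comp (tangentToHom_bijective L)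

end OrientedPlane

namespace OrientedPlane

/-! ### The cross product contraction of tangent vectors -/

/-- For an orthonormal basis `e` of a subspace, the trace `∑ β(eᵢ, eᵢ)` of a bilinear map is the
trace over the ambient space of `β` composed with the orthogonal projection. -/
theorem sum_starProjection_single {ι : Type*} [Fintype ι] {S : Submodule ℝ R7}
    (e : OrthonormalBasis ι ℝ S) (β : R7 →ₗ[ℝ] R7 →ₗ[ℝ] R7) :
    ∑ k, β (S.starProjection (EuclideanSpace.single k 1))
      (S.starProjection (EuclideanSpace.single k 1)) = ∑ i, β (e i) (e i) := by
  classical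
  -- The projection of the `k`-th standard vector has coefficients `(e i) k` in the basis `e`;
  -- orthonormality then collapses the double sum over `i, j` to its diagonal.
  have hexp : ∀ k, S.starProjection (EuclideanSpace.single k (1 : ℝ)) =
      ∑ i, (e i : R7) k • (e i : R7) := by
    intro k
    have h := e.sum_repr' (S.orthogonalProjectionOnto (EuclideanSpace.single k 1))
    have h2 := congrArg (Subtype.val : S → R7) h
    rw [Submodule.coe_sum] at h2
    refine h2.symm.trans (Finset.sum_congr rfl fun i _ => ?_)
    rw [Submodule.coe_smul, Submodule.inner_orthogonalProjectionOnto_eq_of_mem_left,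
      EuclideanSpace.inner_single_right]
    simp
  have horth : ∀ i j, ∑ k, (e i : R7) k * (e j : R7) k = if i = j then 1 else 0 := by
    intro i j
    rw [← orthonormal_iff_ite.1 e.orthonormal i j, Submodule.coe_inner, PiLp.inner_apply]
    refine Finset.sum_congr rfl fun k _ => ?_
    simp [mul_comm]
  have : ∀ k, β (S.starProjection (EuclideanSpace.single k 1))
      (S.starProjection (EuclideanSpace.single k 1)) =
      ∑ i, ∑ j, ((e i : R7) k * (e j : R7) k) • β (e i) (e j) := by
    intro k
    simp only [hexp, map_sum, LinearMap.sum_apply, map_smul, LinearMap.smul_apply, Finset.smul_sum,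
      smul_smul]
    rw [Finset.sum_comm]
    refine Finset.sum_congr rfl fun i _ => Finset.sum_congr rfl fun j _ => ?_
    rw [mul_comm]
  simp only [this]
  rw [Finset.sum_comm]
  refine Finset.sum_congr rfl fun i _ => ?_
  rw [Finset.sum_comm]
  simp only [← Finset.sum_smul, horth]
  simp

/-- The contraction `∑ eⱼ × ξ(eⱼ)` of a tangent vector with the cross product, written without a
choice of a basis of the plane. -/
def crossTrace (L : OrientedPlane) : TangentSpace 𝓘(ℝ, Model) L →ₗ[ℝ] R7 where
  toFun ξ := ∑ k, cross (proj L (EuclideanSpace.single k 1))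
    (dproj L ξ (proj L (EuclideanSpace.single k 1)))
  map_add' ξ η := by
    rw [← Finset.sum_add_distrib]
    refine Finset.sum_congr rfl fun k _ => ?_
    rw [map_add, add_apply, ← crossLin_apply, map_add]
    rfl
  map_smul' c ξ := by
    rw [Finset.smul_sum]
    refine Finset.sum_congr rfl fun k _ => ?_
    rw [map_smul, smul_apply, ← crossLin_apply, map_smul]
    rfl

theorem crossTrace_apply (L : OrientedPlane) (ξ : TangentSpace 𝓘(ℝ, Model) L) :
    crossTrace L ξ = ∑ k, cross (proj L (EuclideanSpace.single k 1))
      (dproj L ξ (proj L (EuclideanSpace.single k 1))) := by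
  simp only [crossTrace, LinearMap.coe_mk, AddHom.coe_mk]

theorem crossTrace_eq_sum {L : OrientedPlane} (e : OrthonormalBasis (Fin 3) ℝ L.E)
    (ξ : TangentSpace 𝓘(ℝ, Model) L) :
    crossTrace L ξ = ∑ j, cross (e j) (dproj L ξ (e j)) := by
  have h := sum_starProjection_single e (crossLin.compl₂ (dproj L ξ).toLinearMap)
  simp only [LinearMap.compl₂_apply, crossLin_apply, ContinuousLinearMap.coe_coe] at h
  rw [crossTrace_apply, ← h]
  rfl

/-- The contraction is polynomial in `proj L` and `dproj L ξ`; the latter is the fibre component of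
the tangent map of the smooth map `proj`. -/
theorem contMDiff_crossTrace : ContMDiff 𝓘(ℝ, Model).tangent 𝓘(ℝ, R7) ∞
    fun p : TangentBundle 𝓘(ℝ, Model) OrientedPlane => crossTrace p.proj p.snd := by
  have h1 : ContMDiff 𝓘(ℝ, Model).tangent 𝓘(ℝ, R7 →L[ℝ] R7) ∞
      fun p : TangentBundle 𝓘(ℝ, Model) OrientedPlane => proj p.proj :=
    contMDiff_proj.comp (Bundle.contMDiff_proj (TangentSpace 𝓘(ℝ, Model)))
  have h2 : ContMDiff 𝓘(ℝ, Model).tangent 𝓘(ℝ, R7 →L[ℝ] R7) ∞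
      fun p : TangentBundle 𝓘(ℝ, Model) OrientedPlane => dproj p.proj p.snd :=
    (contMDiff_snd_tangentBundle_modelSpace (R7 →L[ℝ] R7) 𝓘(ℝ, R7 →L[ℝ] R7)).comp
      (ContMDiff.contMDiff_tangentMap (contMDiff_proj (n := ∞)) le_rfl)
  have h3 : ContDiff ℝ ∞ fun q : (R7 →L[ℝ] R7) × (R7 →L[ℝ] R7) =>
      ∑ k, cross (q.1 (EuclideanSpace.single k 1)) (q.2 (q.1 (EuclideanSpace.single k 1))) := by
    refine ContDiff.sum fun k _ => ?_
    have := (contDiff_fst (𝕜 := ℝ) (n := ∞) (E := R7 →L[ℝ] R7) (F := R7 →L[ℝ] R7)).clm_apply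
      (contDiff_const (c := EuclideanSpace.single k (1 : ℝ)))
    exact this.cross (contDiff_snd.clm_apply this)
  have h4 := h3.contMDiff.comp (h1.prodMk_space h2)
  refine h4.congr fun p => ?_
  rw [crossTrace_apply]
  rfl

/-! ### Cross products at an associative plane -/

/-- The operator `u × ·` is skew and preserves the plane, hence also its orthogonal complement. -/
theorem IsAssociative.cross_mem_orthogonal {L : OrientedPlane} (h : L.IsAssociative) {u v : R7}
    (hu : u ∈ L.plane) (hv : v ∈ L.V) : cross u v ∈ L.V := by
  intro w hw
  rw [real_inner_comm, inner_cross_swap, real_inner_comm, hv _ (h.cross_mem hu hw), neg_zero]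

theorem crossTrace_mem {L : OrientedPlane} (h : L.IsAssociative)
    (ξ : TangentSpace 𝓘(ℝ, Model) L) : crossTrace L ξ ∈ L.V := by
  rw [crossTrace_eq_sum L.frame]
  exact L.V.sum_mem fun j _ => h.cross_mem_orthogonal (L.frame j).2 (dproj_mem ξ (L.frame j).2)

/-- The contraction with the cross product, at an associative plane. -/
def crossTraceV (L : AssociativeGrassmannian) : TangentSpace 𝓘(ℝ, Model) L.1 →ₗ[ℝ] L.1.V :=
  (crossTrace L.1).codRestrict L.1.V (crossTrace_mem L.2)

theorem crossTraceV_surjective (L : AssociativeGrassmannian) :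
    Function.Surjective (crossTraceV L) := by
  intro v
  let e := L.1.frame
  -- The preimage of `v` is `e⁰ ⊗ (-e₀ × v)`, because `e₀ × (e₀ × v) = -v` for `v` orthogonal to the
  -- unit vector `e₀`.
  have hm : -cross (e 0) v ∈ L.1.V :=
    L.1.V.neg_mem (L.2.cross_mem_orthogonal (e 0).2 v.2)
  obtain ⟨ξ, hξ⟩ := (tangentToHom_bijective L.1).2
    ((e.toBasis.coord 0).smulRight (⟨_, hm⟩ : L.1.V))
  have hd : ∀ j, dproj L.1 ξ (e j) = (if j = 0 then (1 : ℝ) else 0) • -cross (e 0) v := by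
    intro j
    have hc : e.toBasis.coord 0 (e j) = if j = 0 then (1 : ℝ) else 0 := by
      rw [← e.coe_toBasis, Basis.coord_apply, Basis.repr_self, Finsupp.single_apply]
    rw [← coe_tangentToHom, hξ, LinearMap.smulRight_apply, Submodule.coe_smul, hc]
  refine ⟨ξ, Subtype.ext ?_⟩
  change crossTrace L.1 ξ = v
  rw [crossTrace_eq_sum e, Fin.sum_univ_three, hd, hd, hd, if_pos rfl, if_neg (by decide),
    if_neg (by decide), zero_smul, one_smul]
  simp only [← crossLin_apply]
  rw [(crossLin (e 1)).map_zero, (crossLin (e 2)).map_zero, map_neg, add_zero, add_zero]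
  simp only [crossLin_apply]
  rw [cross_cross_self, inner_frame, if_pos rfl, v.2 _ (e 0).2]
  simp

/-- Writing `e₀ = e₁ × e₂` and `e₁ = e₂ × e₀`, anti-associativity gives `e₀ × v₀ = e₂ × (e₁ × v₀)`
and `e₁ × v₁ = -e₂ × (e₀ × v₁)`, whose sum cancels `e₂ × v₂`. -/
theorem sum_cross_eq_zero_of_eq {e v : Fin 3 → R7} (he : Orthonormal ℝ e)
    (h : e 2 = cross (e 0) (e 1)) (hv : ∀ i j, (inner ℝ (e i) (v j) : ℝ) = 0)
    (hv2 : v 2 = cross (v 0) (e 1) + cross (e 0) (v 1)) : ∑ j, cross (e j) (v j) = 0 := by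
  have hi := orthonormal_iff_ite.1 he
  have h0 : cross (e 0) (v 0) = -cross (e 1) (cross (e 2) (v 0)) := by
    conv_lhs => rw [← cross_one_two he h]
    exact cross_cross_assoc_of_orthogonal (hi 1 2) (hv 1 0) (hv 2 0)
  have h1 : cross (e 1) (v 1) = -cross (e 2) (cross (e 0) (v 1)) := by
    conv_lhs => rw [← neg_neg (e 1), ← cross_zero_two he h, ← cross_swap]
    exact cross_cross_assoc_of_orthogonal (hi 2 0) (hv 2 1) (hv 0 1)
  have h2 : cross (e 1) (cross (e 2) (v 0)) = -cross (e 2) (cross (e 1) (v 0)) :=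
    cross_cross_of_orthogonal (hi 1 2) (hv 1 0) (hv 2 0)
  rw [Fin.sum_univ_three, h0, h1, h2, hv2, cross_swap (v 0)]
  simp only [← crossLin_apply, map_add, map_neg]
  abel

/-- The differentiated map vanishes at the projection onto any associative plane, so its derivative
yields the linearized equation. -/
theorem hasFDerivAt_cross_sub (Q : R7 →L[ℝ] R7) (u v : R7) :
    ∃ T : (R7 →L[ℝ] R7) →L[ℝ] R7,
      HasFDerivAt (fun Q : R7 →L[ℝ] R7 => cross (Q u) (Q v) - Q (cross (Q u) (Q v))) T Q ∧
      ∀ D, T D = cross (Q u) (D v) + cross (D u) (Q v) -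
        (Q (cross (Q u) (D v) + cross (D u) (Q v)) + D (cross (Q u) (Q v))) := by
  have h1 : HasFDerivAt (fun Q : R7 →L[ℝ] R7 => crossCLM (Q u) (Q v)) _ Q :=
    ((crossCLM.hasFDerivAt (x := Q u)).comp Q
      (ContinuousLinearMap.apply ℝ R7 u).hasFDerivAt).clm_apply
      (ContinuousLinearMap.apply ℝ R7 v).hasFDerivAt
  have h2 := (hasFDerivAt_id (𝕜 := ℝ) Q).clm_apply h1
  refine ⟨_, h1.sub h2, fun D => ?_⟩
  simp [crossCLM_apply]

/-! ### The tangent space and the normal bundle of the associative Grassmannian -/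

section Submanifold

variable [ChartedSpace (EuclideanSpace ℝ (Fin 8)) AssociativeGrassmannian]

theorem assocTangent_le_ker (hι : MDifferentiable (𝓡 8) 𝓘(ℝ, Model)
    (Subtype.val : AssociativeGrassmannian → OrientedPlane)) (L : AssociativeGrassmannian) :
    assocTangent L ≤ LinearMap.ker (crossTraceV L) := by
  rintro _ ⟨η, rfl⟩
  set ξ : TangentSpace 𝓘(ℝ, Model) L.1 := mfderiv (𝓡 8) 𝓘(ℝ, Model)
    (Subtype.val : AssociativeGrassmannian → OrientedPlane) L η with hξ
  let e : Fin 3 → R7 := fun i => L.1.frame i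
  have heL : ∀ i, e i ∈ L.1.plane := fun i => (L.1.frame i).2
  have he2 : e 2 = cross (e 0) (e 1) := L.2.cross_frame.symm
  have hDV : ∀ i, dproj L.1 ξ (e i) ∈ L.1.V := fun i => dproj_mem ξ (heL i)
  have key : dproj L.1 ξ (e 2) = cross (dproj L.1 ξ (e 0)) (e 1) +
      cross (e 0) (dproj L.1 ξ (e 1)) := by
    obtain ⟨T, h3, hT⟩ := hasFDerivAt_cross_sub (proj L.1) (e 0) (e 1)
    have hp : HasMFDerivAt (𝓡 8) 𝓘(ℝ, R7 →L[ℝ] R7) (fun M : AssociativeGrassmannian => proj M.1) L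
        ((dproj L.1).comp (mfderiv (𝓡 8) 𝓘(ℝ, Model)
          (Subtype.val : AssociativeGrassmannian → OrientedPlane) L)) :=
      HasMFDerivAt.comp L ((contMDiff_proj (n := 1)).mdifferentiable one_ne_zero
        L.1).hasMFDerivAt (hι L).hasMFDerivAt
    have h4 := HasMFDerivAt.comp L h3.hasMFDerivAt hp
    have h5 : (fun Q : R7 →L[ℝ] R7 => cross (Q (e 0)) (Q (e 1)) - Q (cross (Q (e 0)) (Q (e 1)))) ∘
        (fun M : AssociativeGrassmannian => proj M.1) = fun _ => 0 := by
      funext M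
      have hm : ∀ u, proj M.1 u ∈ M.1.plane := fun u => Submodule.starProjection_apply_mem _ _
      exact sub_eq_zero.2 (proj_of_mem (M.2.cross_mem (hm _) (hm _))).symm
    rw [h5] at h4
    have h6 := congrArg (fun f => f η) (hasMFDerivAt_unique h4 (hasMFDerivAt_const _ _))
    have h7 : T (dproj L.1 ξ) = 0 := h6
    rw [hT] at h7
    -- At frame vectors the projection is the identity, and it kills `e₀ × v₁ + v₀ × e₁`, which is
    -- normal to the plane.
    rw [proj_of_mem (heL 0), proj_of_mem (heL 1), ← he2, proj_of_mem_orthogonal, zero_add,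
      sub_eq_zero] at h7
    · rw [← h7, add_comm]
    · refine L.1.V.add_mem (L.2.cross_mem_orthogonal (heL 0) (hDV 1)) ?_
      rw [cross_swap]
      exact L.1.V.neg_mem (L.2.cross_mem_orthogonal (heL 1) (hDV 0))
  refine LinearMap.mem_ker.2 (Subtype.ext ?_)
  change crossTrace L.1 ξ = 0
  rw [crossTrace_eq_sum L.1.frame]
  exact sum_cross_eq_zero_of_eq (e := e) (v := fun j => dproj L.1 ξ (e j))
    (orthonormal_iff_ite.2 L.1.inner_frame) he2 (fun i j => hDV j _ (heL i)) key

/-- One inclusion and a dimension count: the kernel of a surjection from dimension 12 to dimension 4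
has dimension 8, as does the image of the injective differential. -/
theorem assocTangent_eq_ker (hι : MDifferentiable (𝓡 8) 𝓘(ℝ, Model)
    (Subtype.val : AssociativeGrassmannian → OrientedPlane))
    (hinj : ∀ L, Function.Injective (mfderiv (𝓡 8) 𝓘(ℝ, Model)
      (Subtype.val : AssociativeGrassmannian → OrientedPlane) L))
    (L : AssociativeGrassmannian) : assocTangent L = LinearMap.ker (crossTraceV L) := by
  refine Submodule.eq_of_le_of_finrank_eq (assocTangent_le_ker hι L) ?_
  have h1 := (crossTraceV L).finrank_range_add_finrank_ker
  rw [LinearMap.range_eq_top.2 (crossTraceV_surjective L), finrank_top, finrank_V,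
    finrank_tangentSpace] at h1
  have h2 : finrank ℝ (assocTangent L) = 8 := by
    refine (LinearMap.finrank_range_of_inj (hinj L)).trans ?_
    exact finrank_euclideanSpace_fin
  omega

/-- The isomorphism of the normal bundle with the complementary bundle. -/
def normalIso (h : ∀ L, assocTangent L = LinearMap.ker (crossTraceV L)) : NormalBundleIso where
  toEquiv L := (Submodule.quotEquivOfEq _ _ (h L)).trans
    ((crossTraceV L).quotKerEquivOfSurjective (crossTraceV_surjective L))
  contMDiffOn := by
    refine contMDiff_crossTrace.contMDiffOn.congr fun p hp => ?_
    have hp : p.proj.IsAssociative := hp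
    rw [normalMapLift, dif_pos hp]
    rfl

theorem coe_normalIso_mk (h : ∀ L, assocTangent L = LinearMap.ker (crossTraceV L))
    (L : AssociativeGrassmannian) (ξ : TangentSpace 𝓘(ℝ, Model) L.1) :
    ((normalIso h).toEquiv L (Submodule.Quotient.mk ξ) : R7) = crossTrace L.1 ξ := rfl

end Submanifold

/-- Evaluating the tensor at `eⱼ` recovers `vⱼ`; this translates the tensor form of the theorem into
statements about `crossTrace`. -/
theorem tangentToTensor_eq_iff {L : OrientedPlane} (e : OrthonormalBasis (Fin 3) ℝ L.E)
    (ξ : TangentSpace 𝓘(ℝ, Model) L) (v : Fin 3 → L.V) :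
    tangentToTensor L ξ = ∑ j, e.toBasis.coord j ⊗ₜ[ℝ] v j ↔
      ∀ j, (v j : R7) = dproj L ξ (e j) := by
  change (dualTensorHomEquiv ℝ L.E L.V).symm (tangentToHom L ξ) = _ ↔ _
  rw [LinearEquiv.symm_apply_eq, map_sum]
  have key : ∀ j, (∑ i, dualTensorHomEquiv ℝ L.E L.V (e.toBasis.coord i ⊗ₜ[ℝ] v i)) (e j) =
      v j := by
    intro j
    have hi : ∀ i, dualTensorHomEquiv ℝ L.E L.V (e.toBasis.coord i ⊗ₜ[ℝ] v i) (e j) =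
        if j = i then v i else 0 := fun i => by
      rw [dualTensorHomEquiv, LinearEquiv.ofBijective_apply, dualTensorHom_apply, ← e.coe_toBasis,
        Basis.coord_apply, Basis.repr_self, Finsupp.single_apply, ite_smul, one_smul, zero_smul]
    simp only [LinearMap.sum_apply, hi, Finset.sum_ite_eq, Finset.mem_univ, if_true]
  constructor
  · intro h j
    rw [← coe_tangentToHom, h, key]
  · intro h
    refine e.toBasis.ext fun j => Subtype.ext ?_
    rw [e.coe_toBasis, key, coe_tangentToHom, h]

end OrientedPlane

end

open OrientedPlane

theorem lemma5 :
    -- the canonical map `T_L G(3,7) → E_L* ⊗ V_L` is an isomorphism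
    (∀ L : OrientedPlane, Function.Bijective L.tangentToTensor) ∧
    -- the associative Grassmannian is a smooth embedded submanifold of `G(3,7)`
    ∃ _ : ChartedSpace (EuclideanSpace ℝ (Fin 8)) AssociativeGrassmannian,
      IsManifold (𝓡 8) ∞ AssociativeGrassmannian ∧
      Manifold.IsSmoothEmbedding (𝓡 8) 𝓘(ℝ, OrientedPlane.Model) ∞
        (Subtype.val : AssociativeGrassmannian → OrientedPlane) ∧
      -- its tangent space at `L = ⟨e₁, e₂, e₁ × e₂⟩`
      (∀ (L : AssociativeGrassmannian) (e : OrthonormalBasis (Fin 3) ℝ L.1.E),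
        (e 2 : R7) = cross (e 0) (e 1) →
          L.1.tangentToTensor '' (assocTangent L : Set _) =
            {x | ∃ v : Fin 3 → L.1.V,
              x = ∑ j, e.toBasis.coord j ⊗ₜ[ℝ] v j ∧ ∑ j, cross (e j) (v j) = 0}) ∧
      -- its normal bundle is isomorphic to `V`, through the cross product
      ∃ Φ : NormalBundleIso,
        ∀ (L : AssociativeGrassmannian) (e : OrthonormalBasis (Fin 3) ℝ L.1.E),
          (e 2 : R7) = cross (e 0) (e 1) →
            ∀ (ξ : TangentSpace 𝓘(ℝ, OrientedPlane.Model) L.1) (v : Fin 3 → L.1.V),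
              L.1.tangentToTensor ξ = ∑ j, e.toBasis.coord j ⊗ₜ[ℝ] v j →
                (Φ.toEquiv L (Submodule.Quotient.mk ξ) : R7) = ∑ j, cross (e j) (v j) := by
  refine ⟨tangentToTensor_bijective, assocSliceAtlas.chartedSpace, ?_⟩
  let : ChartedSpace (EuclideanSpace ℝ (Fin 8)) AssociativeGrassmannian :=
    assocSliceAtlas.chartedSpace
  have hman : IsManifold (𝓡 8) ∞ AssociativeGrassmannian := assocSliceAtlas.isManifold
  have himm : Manifold.IsImmersionOfComplement (Fin 4 → ℝ) (𝓡 8) 𝓘(ℝ, OrientedPlane.Model) ∞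
      (Subtype.val : AssociativeGrassmannian → OrientedPlane) :=
    assocSliceAtlas.isImmersionOfComplement
  have : IsManifold (𝓡 8) 1 AssociativeGrassmannian := IsManifold.of_le (n := ∞) (by simp)
  have hker := assocTangent_eq_ker (himm.contMDiff.mdifferentiable (by simp))
    fun L => (himm L).mfderiv_injective (by simp)
  refine ⟨hman, ⟨himm.isImmersion, Topology.IsEmbedding.subtypeVal⟩, fun L e _ => ?_,
    normalIso hker, fun L e _ ξ v hv => ?_⟩
  · ext x
    constructor
    · rintro ⟨ξ, hξ, rfl⟩
      rw [SetLike.mem_coe, hker, LinearMap.mem_ker] at hξ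
      have h0 : crossTrace L.1 ξ = 0 := congrArg Subtype.val hξ
      rw [crossTrace_eq_sum e] at h0
      exact ⟨fun j => ⟨_, dproj_mem ξ (e j).2⟩,
        (tangentToTensor_eq_iff e ξ _).2 fun j => rfl, h0⟩
    · rintro ⟨v, rfl, hv⟩
      obtain ⟨ξ, hξ⟩ := (tangentToTensor_bijective L.1).2 (∑ j, e.toBasis.coord j ⊗ₜ[ℝ] v j)
      refine ⟨ξ, ?_, hξ⟩
      rw [SetLike.mem_coe, hker, LinearMap.mem_ker]
      refine Subtype.ext ?_
      change crossTrace L.1 ξ = 0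
      rw [crossTrace_eq_sum e, ← hv]
      simp only [(tangentToTensor_eq_iff e ξ v).1 hξ]
  · rw [coe_normalIso_mk, crossTrace_eq_sum e]
    simp only [(tangentToTensor_eq_iff e ξ v).1 hv]
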